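/- **Conventions.** A c.e. set is a recursively enumerable one. All finite objects (natural numbers, rationals, tuples, matrices, rational polynomials given as lists of terms) are coded by natural numbers in a standard effective way. Let $\mathcal A_{\mathbf Q}$ be the class of finite unions of bounded open intervals with rational endpoints in $\mathbf R$, and $\mathcal A_{\mathbf Q^k}$ the class of finite unions of open rectangles in $\mathbf R^k$ whose sides are such intervals; elements of these classes are named by finite lists of endpoints. Let $X=(X_i)_{i\ge 1}$ be an exchangeable sequence of real random variables on a probability space, with distribution $\chi$ on $\mathbf R^{\omega}$, and let $\nu$ be a directing random measure of $X$, i.e. a random probability measure on $\mathbf R$ with $\Pr[X\in\cdot\mid\nu]=\nu^\infty$ a.s. Put $V_\gamma:=\nu(\gamma)$ for Borel $\gamma\subseteq\mathbf R$; for $\sigma=(\sigma(1),\dots,\sigma(k))\in\mathcal A_{\mathbf Q}^k$ put $V_\sigma:=(V_{\sigma(1)},\dots,V_{\sigma(k)})$ and $V_{\overline\sigma}:=(V_{\overline{\sigma(1)}},\dots,V_{\overline{\sigma(k)}})$, where the bar is topological closure. The representation of $\chi$ is the set of (codes of) pairs $(B,q)$ with $q\in\mathbf Q$, $B$ a finite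 union of cylinders $\tau\times\mathbf R^\omega$ over open rectangles $\tau$ with rational endpoints in some $\mathbf R^j$, $j\ge1$, and $\chi(B)>q$. An *approximating array* is a computable array of rational polynomials $p_{n,s}$ (computable from $n$, $k$ and a name of $s$), indexed by $n\in\omega$, $k\ge 1$ and (names of) $s\in\mathcal A_{\mathbf Q^k}$, where $p_{n,s}$ has $k$ variables and, for all $x\in[0,1]^k$, $$-1\le p_{n,s}(x)\le \mathbf 1_s(x)\quad\text{for all } n\in\omega,\qquad \lim_{n\to\infty}p_{n,s}(x)=\mathbf 1_s(x).$$ Given such an array, for $k,m\ge1$ and $C=(c_{ij})\in\mathbf Q^{m\times k}$ let $p_{n,C}:=p_{n,s}$ with $s=\bigcup_{i=1}^m (c_{i1},2)\times\dots\times(c_{ik},2)$; let $p^+_{n,C}$ be the sum of the terms of $p_{n,C}$ with positive coefficient, let $p^-_{n,C}:=p^+_{n,C}-p_{n,C}$, and let $$q_{n,C}(x_1,\dots,x_k,y_1,\dots,y_k):=p^+_{n,C}(x_1,\dots,x_k)-p^-_{n,C}(y_1,\dots,y_k).$$ **Proposition.** Approximating arrays exist. For every approximating array, the expectation $$\mathbb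 E\, q_{n,C}(V_\sigma,V_{\overline\sigma})$$ is a c.e. real relative to $\chi$, uniformly in $n\in\omega$, $k,m\ge1$, $\sigma\in\mathcal A_{\mathbf Q}^k$ and $C\in\mathbf Q^{m\times k}$. That is, there is a single oracle program which, for every such $X$ and $\nu$, given the representation of $\chi$ as oracle and $(n,\sigma,C)$ as input, enumerates the set of all rationals less than $\mathbb E\, q_{n,C}(V_\sigma,V_{\overline\sigma})$. -/

import Mathlib

open MeasureTheory ProbabilityTheory Filter Topology

noncomputable section

namespace DeFinetti

/-- Code of a rational number: numerator and denominator. -/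
def ratCode (q : ℚ) : ℕ := Nat.pair (Encodable.encode q.num) q.den

/-! ### Oracle programs -/

/-- Programs with access to an oracle: the usual schemes generating the partial recursive
functions, together with an instruction that queries the oracle. -/
inductive OracleProgram : Type
  | zero : OracleProgram
  | succ : OracleProgram
  | left : OracleProgram
  | right : OracleProgram
  | oracle : OracleProgram
  | pair : OracleProgram → OracleProgram → OracleProgram
  | comp : OracleProgram → OracleProgram → OracleProgram
  | prec : OracleProgram → OracleProgram → OracleProgram
  | rfind : OracleProgram → OracleProgram

open Classical in
/-- The partial function computed by a program when the oracle is the set `A` (a query `n`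
is answered by `1` if `n ∈ A` and by `0` otherwise). -/
def OracleProgram.eval (A : Set ℕ) : OracleProgram → ℕ →. ℕ
  | .zero => fun _ => Part.some 0
  | .succ => fun n => Part.some (n + 1)
  | .left => fun n => Part.some n.unpair.1
  | .right => fun n => Part.some n.unpair.2
  | .oracle => fun n => Part.some (if n ∈ A then 1 else 0)
  | .pair f g => fun n => Nat.pair <$> f.eval A n <*> g.eval A n
  | .comp f g => fun n => g.eval A n >>= f.eval A
  | .prec f g => fun n =>
      n.unpair.2.rec (f.eval A n.unpair.1) fun y ih => do
        let i ← ih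
        g.eval A (Nat.pair n.unpair.1 (Nat.pair y i))
  | .rfind f => fun a => Nat.rfind fun n => (fun m => decide (m = 0)) <$> f.eval A (Nat.pair a n)

/-- With oracle `A`, the program `e` enumerates (as the domain of the partial function it
computes) the set of all rationals below `r`, when it is given the index `i`.  Thus `r` is a c.e.
real relative to `A`, by a program that is uniform in whatever `i` encodes. -/
def OracleProgram.EnumeratesLowerCut (e : OracleProgram) (A : Set ℕ) (i : ℕ) (r : ℝ) : Prop :=
  ∀ q : ℚ, (e.eval A (Nat.pair i (ratCode q))).Dom ↔ (q : ℝ) < r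

/-! ### Codes of finite objects -/

/-- Code of a finite list of natural numbers. -/
def listCode (l : List ℕ) : ℕ := Encodable.encode l

/-- Code of a finite list of pairs of rationals (endpoints of intervals). -/
def intervalsCode (l : List (ℚ × ℚ)) : ℕ :=
  listCode (l.map fun I => Nat.pair (ratCode I.1) (ratCode I.2))

/-- Code of a finite list of lists of pairs of rationals. -/
def boxesCode (l : List (List (ℚ × ℚ))) : ℕ := listCode (l.map intervalsCode)

/-- Code of a rational `m × k` matrix. -/
def matrixCode {m k : ℕ} (C : Matrix (Fin m) (Fin k) ℚ) : ℕ :=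
  listCode (List.ofFn fun i => listCode (List.ofFn fun j => ratCode (C i j)))

/-- Code of a rational polynomial in `k` variables, presented as a list of terms (exponent vector
and coefficient). -/
def termsCode {k : ℕ} (L : List ((Fin k → ℕ) × ℚ)) : ℕ :=
  listCode (L.map fun t => Nat.pair (listCode (List.ofFn t.1)) (ratCode t.2))

/-- The polynomial presented by a list of terms. -/
def termsPoly {k : ℕ} (L : List ((Fin k → ℕ) × ℚ)) : MvPolynomial (Fin k) ℚ :=
  (L.map fun t => MvPolynomial.monomial (Finsupp.equivFunOnFinite.symm t.1) t.2).sum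

/-! ### Finite unions of open rational rectangles -/

/-- The element of the rational algebra on `ℝ` named by a list of pairs of endpoints: the union of
the corresponding open intervals. -/
def ratOpen (U : List (ℚ × ℚ)) : Set ℝ := ⋃ I ∈ U, Set.Ioo (I.1 : ℝ) (I.2 : ℝ)

/-- The element of the rational algebra on `ℝ^k` named by a list of rational rectangles: their
union. -/
def boxUnion {k : ℕ} (s : List (Fin k → ℚ × ℚ)) : Set (Fin k → ℝ) :=
  ⋃ B ∈ s, Set.univ.pi fun j => Set.Ioo ((B j).1 : ℝ) ((B j).2 : ℝ)

/-- The cylinder over the open rational rectangle with sides `τ`, in the space of real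
sequences. -/
def seqCylinder (τ : List (ℚ × ℚ)) : Set (ℕ → ℝ) :=
  {x | ∀ i : Fin τ.length, x i ∈ Set.Ioo ((τ.get i).1 : ℝ) ((τ.get i).2 : ℝ)}

/-- The representation of a distribution `χ` on real sequences: the set of (codes of) pairs `(B, q)`
where `B` is a finite union of cylinders over open rational rectangles of dimension at least `1`
and `q` is a rational with `χ B > q`. -/
def representation (χ : Measure (ℕ → ℝ)) : Set ℕ :=
  {c | ∃ (B : List (List (ℚ × ℚ))) (q : ℚ), (∀ τ ∈ B, τ ≠ []) ∧
    (q : ℝ) < χ.real (⋃ τ ∈ B, seqCylinder τ) ∧ c = Nat.pair (boxesCode B) (ratCode q)}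

/-! ### Polynomials approximating indicators -/

/-- `p k n s` is a computable array of rational polynomials, `p k n s` being in `k` variables,
which on the unit cube are at least `-1`, are at most the indicator of the finite union `s` of
open rational rectangles, and converge pointwise to that indicator as `n → ∞`. -/
structure IsApproximatingArray
    (p : (k : ℕ) → ℕ → List (Fin k → ℚ × ℚ) → MvPolynomial (Fin k) ℚ) : Prop where
  computable : ∃ f : ℕ → ℕ, Computable f ∧
    ∀ k : ℕ, 1 ≤ k → ∀ (n : ℕ) (s : List (Fin k → ℚ × ℚ)),
      ∃ L : List ((Fin k → ℕ) × ℚ), p k n s = termsPoly L ∧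
        f (Nat.pair n (Nat.pair k (boxesCode (s.map List.ofFn)))) = termsCode L
  bounds : ∀ k : ℕ, 1 ≤ k → ∀ (n : ℕ) (s : List (Fin k → ℚ × ℚ)) (x : Fin k → ℝ),
    (∀ j, x j ∈ Set.Icc (0 : ℝ) 1) →
      -1 ≤ MvPolynomial.aeval x (p k n s) ∧
        MvPolynomial.aeval x (p k n s) ≤ (boxUnion s).indicator (fun _ => (1 : ℝ)) x
  limit : ∀ k : ℕ, 1 ≤ k → ∀ (s : List (Fin k → ℚ × ℚ)) (x : Fin k → ℝ),
    (∀ j, x j ∈ Set.Icc (0 : ℝ) 1) →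
      Tendsto (fun n => MvPolynomial.aeval x (p k n s)) atTop
        (𝓝 ((boxUnion s).indicator (fun _ => (1 : ℝ)) x))

/-- The sum of the terms of a polynomial with positive coefficient. -/
def positivePart {k : ℕ} (p : MvPolynomial (Fin k) ℚ) : MvPolynomial (Fin k) ℚ :=
  ∑ a ∈ p.support, MvPolynomial.monomial a (max (p.coeff a) 0)

/-- Minus the sum of the terms of a polynomial with negative coefficient. -/
def negativePart {k : ℕ} (p : MvPolynomial (Fin k) ℚ) : MvPolynomial (Fin k) ℚ :=
  ∑ a ∈ p.support, MvPolynomial.monomial a (max (-p.coeff a) 0)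

/-- The `2k`-variable polynomial `p⁺(x) - p⁻(y)`. -/
def splitPoly {k : ℕ} (p : MvPolynomial (Fin k) ℚ) : MvPolynomial (Fin k ⊕ Fin k) ℚ :=
  MvPolynomial.rename Sum.inl (positivePart p) - MvPolynomial.rename Sum.inr (negativePart p)

/-- The polynomial `p_{n,C}`: the member of the array belonging to the union over the rows `i` of
the rectangles `(c i 1, 2) × ⋯ × (c i k, 2)`. -/
def matrixPoly (p : (k : ℕ) → ℕ → List (Fin k → ℚ × ℚ) → MvPolynomial (Fin k) ℚ)
    {m k : ℕ} (n : ℕ) (C : Matrix (Fin m) (Fin k) ℚ) : MvPolynomial (Fin k) ℚ :=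
  p k n (List.ofFn fun i => fun j => (C i j, 2))

/-! ### Exchangeable sequences and directing random measures -/

/-- Exchangeability: any `j` variables with distinct indices have the same joint distribution
as the first `j` variables. -/
def Exchangeable {Ω : Type*} [MeasurableSpace Ω] (P : Measure Ω) (X : ℕ → Ω → ℝ) : Prop :=
  ∀ (j : ℕ) (κ : Fin j → ℕ), Function.Injective κ →
    P.map (fun ω (i : Fin j) => X (κ i) ω) = P.map (fun ω (i : Fin j) => X i ω)

/-- The random probability measure `ν` is a directing random measure of `X`: conditionally on `ν`,
the sequence `X` has distribution `ν^∞`, almost surely. -/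
def IsDirectingMeasure {Ω : Type*} [MeasurableSpace Ω] (P : Measure Ω) (X : ℕ → Ω → ℝ)
    (ν : Kernel Ω ℝ) [IsMarkovKernel ν] : Prop :=
  ∀ A : Set (ℕ → ℝ), MeasurableSet A →
    P⟦(fun ω i => X i ω) ⁻¹' A | MeasurableSpace.comap (fun ω => ν ω) inferInstance⟧
      =ᵐ[P] fun ω => (Measure.infinitePi fun _ : ℕ => ν ω).real A

/-- The expectation of `q(V_σ, V_{closure σ})`, where `V_γ = ν γ`. -/
def expectedValue {Ω : Type*} [MeasurableSpace Ω] (P : Measure Ω) (ν : Kernel Ω ℝ) {k : ℕ}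
    (q : MvPolynomial (Fin k ⊕ Fin k) ℚ) (σ : Fin k → List (ℚ × ℚ)) : ℝ :=
  ∫ ω, MvPolynomial.aeval
    (Sum.elim (fun i => (ν ω).real (ratOpen (σ i)))
      (fun i => (ν ω).real (closure (ratOpen (σ i))))) q ∂P

end DeFinetti

end

namespace DeFinetti
open Encodable

/-! ### Primitive recursive arithmetic of integers -/

/-! Expand the expectation into monomials. Since `ν` directs `X`, the expectation of `∏ ν(γ i) ^ a
i` is the probability that the first `∑ a i` variables lie in prescribed sets, each `γ i` being used
`a i` times (`map_real_pi_eq_integral`, `prod_range_positions`). For the open sets named by `σ` this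
is the probability of an open event, which the representation of `χ` bounds from below. For their
closures it is one minus the probability of an open event, hence bounded from above. The split
polynomial puts open sets into the terms with positive coefficient and closures into those with
negative coefficient, so every term is a nondecreasing function of the probability of one open event
(`contribution_mono`, `expectedValue_eq`).

Each of these events is a union of rational cylinders picked out by decidable conditions on
endpoints (`biUnion_containedCylinder`, `biUnion_disjointCylinder`), and finitely many of them
already approximate its probability. Hence a rational `q` lies below the expectation iff there is a
finite certificate: for each monomial a finite list of such cylinders and a rational strictly below
the probability of their union, with contributions summing to more than `q`
(`exists_certifies_iff`). Checking it is computable apart from finitely many positive oracle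
answers, so one search program serves all distributions (`exists_search_program`).

For the existence of arrays, the indicator of `g > 1/2` on `[0,1]` is approximated by `1 - (1 - g ^
N) ^ M` with `N` near `n²` and `M = 2 ^ (n²)`. Products of such polynomials in linear `g`
approximate boxes, and `1 - ∏ (1 - ·)` approximates unions. Off the union the error is at most `2 ^
(-n)`; subtracting this gives a lower approximation (`steep_le`, `tendsto_steep`,
`eval_unionApprox_bounds`). -/

theorem encode_int_natCast (n : ℕ) : encode (n : ℤ) = 2 * n := rfl

theorem encode_int_negSucc (n : ℕ) : encode (Int.negSucc n) = 2 * n + 1 := rfl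

theorem primrec_int_ofNat : Primrec (fun n : ℕ => (n : ℤ)) :=
  Primrec.encode_iff.1 (Primrec.nat_double.of_eq fun n => (encode_int_natCast n).symm)

theorem primrec_int_negSucc : Primrec Int.negSucc :=
  Primrec.encode_iff.1 (Primrec.nat_double_succ.of_eq fun n => (encode_int_negSucc n).symm)

/-- The parity of the code of an integer is its sign, and halving the code recovers the natural
number. -/
theorem primrec_int_toNat : Primrec Int.toNat := by
  refine (Primrec.ite (c := fun z : ℤ => encode z % 2 = 0)
    (Primrec.eq.comp (Primrec.nat_mod.comp Primrec.encode (Primrec.const 2)) (Primrec.const 0))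
    (Primrec.nat_div2.comp Primrec.encode) (Primrec.const 0)).of_eq ?_
  rintro (n | n)
  · simp [encode_int_natCast]
  · simp [encode_int_negSucc, Nat.add_mod]

theorem primrec_int_neg : Primrec (fun z : ℤ => -z) := by
  have hneg : Primrec (fun n : ℕ => -(n : ℤ)) := by
    refine (Primrec.nat_casesOn (h := fun _ n => Int.negSucc n) Primrec.id (Primrec.const 0)
      (primrec_int_negSucc.comp Primrec.snd)).of_eq ?_
    rintro (_ | n) <;> simp [Int.negSucc_eq]
  refine (Primrec.ite (c := fun z : ℤ => encode z % 2 = 0)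
    (Primrec.eq.comp (Primrec.nat_mod.comp Primrec.encode (Primrec.const 2)) (Primrec.const 0))
    (hneg.comp (Primrec.nat_div2.comp Primrec.encode))
    (primrec_int_ofNat.comp (Primrec.succ.comp (Primrec.nat_div2.comp Primrec.encode)))).of_eq ?_
  rintro (n | n)
  · simp [encode_int_natCast]
  · have : (2 * n + 1).div2 = n := by simp
    rw [encode_int_negSucc, this, if_neg (by omega), Int.negSucc_eq]
    simp

theorem primrec_int_subNat : Primrec₂ (fun a b : ℕ => (a : ℤ) - b) := by
  refine (Primrec.ite (c := fun p : ℕ × ℕ => p.2 ≤ p.1) (Primrec.nat_le.comp Primrec.snd Primrec.fst)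
    (primrec_int_ofNat.comp (Primrec.nat_sub.comp Primrec.fst Primrec.snd))
    (primrec_int_neg.comp (primrec_int_ofNat.comp
      (Primrec.nat_sub.comp Primrec.snd Primrec.fst)))).of_eq ?_
  rintro ⟨a, b⟩
  dsimp only
  split_ifs <;> omega

/-- Writing each integer as the difference of its positive and negative parts reduces the operation
to natural numbers; multiplication is treated alike. -/
theorem primrec_int_add : Primrec₂ (fun a b : ℤ => a + b) := by
  have hp := primrec_int_toNat
  have hm := primrec_int_toNat.comp primrec_int_neg
  refine (primrec_int_subNat.comp (Primrec.nat_add.comp (hp.comp Primrec.fst) (hp.comp Primrec.snd))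
    (Primrec.nat_add.comp (hm.comp Primrec.fst) (hm.comp Primrec.snd))).of_eq ?_
  rintro ⟨a, b⟩
  dsimp only
  omega

theorem primrec_int_mul : Primrec₂ (fun a b : ℤ => a * b) := by
  have hp := primrec_int_toNat
  have hm := primrec_int_toNat.comp primrec_int_neg
  refine (primrec_int_subNat.comp
    (Primrec.nat_add.comp (Primrec.nat_mul.comp (hp.comp Primrec.fst) (hp.comp Primrec.snd))
      (Primrec.nat_mul.comp (hm.comp Primrec.fst) (hm.comp Primrec.snd)))
    (Primrec.nat_add.comp (Primrec.nat_mul.comp (hp.comp Primrec.fst) (hm.comp Primrec.snd))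
      (Primrec.nat_mul.comp (hm.comp Primrec.fst) (hp.comp Primrec.snd)))).of_eq ?_
  rintro ⟨a, b⟩
  have ha : a = a.toNat - (-a).toNat := by omega
  have hb : b = b.toNat - (-b).toNat := by omega
  dsimp only
  push_cast
  conv_rhs => rw [ha, hb]
  ring

theorem primrec_int_lt : PrimrecRel (fun a b : ℤ => a < b) := by
  have h := primrec_int_toNat.comp (primrec_int_add.comp Primrec.snd
    (primrec_int_neg.comp (Primrec.fst (α := ℤ) (β := ℤ))))
  refine (Primrec.nat_lt.comp (Primrec.const 0) h).of_eq ?_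
  rintro ⟨a, b⟩
  dsimp only
  omega

theorem primrec_int_natAbs : Primrec Int.natAbs := by
  refine (Primrec.nat_add.comp primrec_int_toNat (primrec_int_toNat.comp primrec_int_neg)).of_eq ?_
  intro a
  omega

/-! ### Primitive recursive arithmetic of rational numbers -/

theorem primrec_nat_gcd : Primrec₂ Nat.gcd := by
  have hdvd {α : Type} [Primcodable α] {f g : α → ℕ} (hf : Primrec f) (hg : Primrec g) :
      PrimrecPred fun a => f a ∣ g a :=
    (Primrec.eq.comp (Primrec.nat_mod.comp hg hf) (Primrec.const 0)).of_eq fun a =>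
      (Nat.dvd_iff_mod_eq_zero).symm
  -- The search bound `a + b` also covers the cases where one argument is `0`, in which the gcd is
  -- the other argument.
  refine (Primrec.nat_findGreatest (f := fun p : ℕ × ℕ => p.1 + p.2)
    (p := fun p d => d ∣ p.1 ∧ d ∣ p.2)
    (Primrec.nat_add.comp Primrec.fst Primrec.snd)
    ((hdvd Primrec.snd (Primrec.fst.comp Primrec.fst)).and
      (hdvd Primrec.snd (Primrec.snd.comp Primrec.fst)))).of_eq ?_
  rintro ⟨a, b⟩
  dsimp only
  rcases Nat.eq_zero_or_pos (a + b) with h | h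
  · obtain ⟨rfl, rfl⟩ : a = 0 ∧ b = 0 := by omega
    simp
  · refine le_antisymm ?_ (Nat.le_findGreatest ?_ ⟨Nat.gcd_dvd_left a b, Nat.gcd_dvd_right a b⟩)
    · have h1 : a.gcd b ≠ 0 := by
        rw [Ne, Nat.gcd_eq_zero_iff]; omega
      have hsp := Nat.findGreatest_spec (P := fun d => d ∣ a ∧ d ∣ b) (m := 1) (n := a + b) h
        ⟨one_dvd _, one_dvd _⟩
      exact Nat.le_of_dvd (Nat.pos_of_ne_zero h1) (Nat.dvd_gcd hsp.1 hsp.2)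
    · rcases Nat.eq_zero_or_pos a with ha | ha
      · subst ha; simp
      · exact (Nat.gcd_le_left b ha).trans (by omega)

/-- Rational numbers as reduced pairs of numerator and denominator. -/
def ratEquiv : ℚ ≃ {p : ℤ × ℕ // p.2 ≠ 0 ∧ p.1.natAbs.gcd p.2 = 1} where
  toFun q := ⟨(q.num, q.den), q.den_nz, q.reduced⟩
  invFun p := ⟨p.1.1, p.1.2, p.2.1, p.2.2⟩
  left_inv _ := rfl
  right_inv _ := rfl

theorem primrecPred_reduced :
    PrimrecPred fun p : ℤ × ℕ => p.2 ≠ 0 ∧ p.1.natAbs.gcd p.2 = 1 :=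
  (PrimrecPred.not (Primrec.eq.comp Primrec.snd (Primrec.const 0))).and
    (Primrec.eq.comp (primrec_nat_gcd.comp (primrec_int_natAbs.comp Primrec.fst) Primrec.snd)
      (Primrec.const 1))

/-- Rational numbers, coded by `ratCode`. -/
instance primcodableRat : Primcodable ℚ :=
  haveI := Primcodable.subtype primrecPred_reduced
  Primcodable.ofEquiv _ ratEquiv

theorem primrec_rat_num : Primrec Rat.num := by
  let := Primcodable.subtype primrecPred_reduced
  exact Primrec.fst.comp (Primrec.subtype_val.comp (Primrec.of_equiv (e := ratEquiv)))

theorem primrec_rat_den : Primrec Rat.den := by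
  let := Primcodable.subtype primrecPred_reduced
  exact Primrec.snd.comp (Primrec.subtype_val.comp (Primrec.of_equiv (e := ratEquiv)))

/-- Division truncated towards zero. Its only use is with a divisor of `z`, where it is the exact
quotient. -/
theorem primrec_int_divNat : Primrec₂ (fun (z : ℤ) (d : ℕ) => if 0 ≤ z then ((z.natAbs / d : ℕ) : ℤ)
    else -((z.natAbs / d : ℕ) : ℤ)) := by
  have h := Primrec.nat_div.comp (primrec_int_natAbs.comp (Primrec.fst (α := ℤ) (β := ℕ)))
    Primrec.snd
  refine Primrec.ite ((primrec_int_lt.comp Primrec.fst (Primrec.const 0)).not.of_eq fun p => not_lt)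
    (primrec_int_ofNat.comp h) (primrec_int_neg.comp (primrec_int_ofNat.comp h))

theorem primrec_rat_mk : Primrec₂ (fun (z : ℤ) (d : ℕ) => (z / d : ℚ)) := by
  have hg := primrec_nat_gcd.comp (primrec_int_natAbs.comp (Primrec.fst (α := ℤ) (β := ℕ)))
    Primrec.snd
  have h : Primrec fun p : ℤ × ℕ => ratCode (p.1 / p.2 : ℚ) := by
    refine (Primrec.ite (c := fun p : ℤ × ℕ => p.2 = 0)
      (Primrec.eq.comp Primrec.snd (Primrec.const 0)) (Primrec.const (ratCode 0))
      (Primrec₂.natPair.comp (Primrec.encode.comp (primrec_int_divNat.comp Primrec.fst hg))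
        (Primrec.nat_div.comp Primrec.snd hg))).of_eq ?_
    rintro ⟨z, d⟩
    dsimp only
    split_ifs with hd hz
    · simp [hd]
    all_goals
      rw [← Rat.mkRat_eq_div, ratCode, Rat.num_mkRat, Rat.den_mkRat, if_neg hd, if_neg hd,
        Nat.gcd_comm d]
      congr 2
    · obtain ⟨n, rfl⟩ := Int.eq_ofNat_of_zero_le hz
      simp
    · obtain ⟨n, hn⟩ := Int.eq_ofNat_of_zero_le (a := -z) (by omega)
      obtain rfl : z = -n := by omega
      rw [Int.neg_ediv_of_dvd (by simpa using! Int.natCast_dvd_natCast.2 (Nat.gcd_dvd_left n d))]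
      simp
  -- The encoding that `ℚ` inherits from reduced pairs is `ratCode` by definition.
  exact Primrec.encode_iff.1 h

theorem primrec_rat_add : Primrec₂ (fun a b : ℚ => a + b) := by
  have hn := primrec_rat_num
  have hd := primrec_rat_den
  have hdz := primrec_int_ofNat.comp primrec_rat_den
  refine (primrec_rat_mk.comp (primrec_int_add.comp
    (primrec_int_mul.comp (hn.comp Primrec.fst) (hdz.comp Primrec.snd))
    (primrec_int_mul.comp (hn.comp Primrec.snd) (hdz.comp Primrec.fst)))
    (Primrec.nat_mul.comp (hd.comp Primrec.fst) (hd.comp Primrec.snd))).of_eq ?_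
  rintro ⟨a, b⟩
  have ha : (a.den : ℚ) ≠ 0 := by exact_mod_cast a.den_nz
  have hb : (b.den : ℚ) ≠ 0 := by exact_mod_cast b.den_nz
  dsimp only
  push_cast
  conv_rhs => rw [← Rat.num_div_den a, ← Rat.num_div_den b]
  field_simp

theorem primrec_rat_mul : Primrec₂ (fun a b : ℚ => a * b) := by
  have hn := primrec_rat_num
  have hd := primrec_rat_den
  refine (primrec_rat_mk.comp
    (primrec_int_mul.comp (hn.comp Primrec.fst) (hn.comp Primrec.snd))
    (Primrec.nat_mul.comp (hd.comp Primrec.fst) (hd.comp Primrec.snd))).of_eq ?_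
  rintro ⟨a, b⟩
  have ha : (a.den : ℚ) ≠ 0 := by exact_mod_cast a.den_nz
  have hb : (b.den : ℚ) ≠ 0 := by exact_mod_cast b.den_nz
  dsimp only
  push_cast
  conv_rhs => rw [← Rat.num_div_den a, ← Rat.num_div_den b]
  field_simp

theorem primrec_rat_neg : Primrec (fun a : ℚ => -a) :=
  (primrec_rat_mul.comp (Primrec.const (-1)) Primrec.id).of_eq fun a => by simp

theorem primrec_rat_sub : Primrec₂ (fun a b : ℚ => a - b) :=
  (primrec_rat_add.comp Primrec.fst (primrec_rat_neg.comp Primrec.snd)).of_eq fun a => by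
    simp [sub_eq_add_neg]

theorem primrec_rat_lt : PrimrecRel (fun a b : ℚ => a < b) := by
  have hn := primrec_rat_num
  have hdz := primrec_int_ofNat.comp primrec_rat_den
  refine (primrec_int_lt.comp
    (primrec_int_mul.comp (hn.comp Primrec.fst) (hdz.comp Primrec.snd))
    (primrec_int_mul.comp (hn.comp Primrec.snd) (hdz.comp Primrec.fst))).of_eq ?_
  rintro ⟨a, b⟩
  exact (Rat.lt_iff a b).symm

theorem primrec_rat_le : PrimrecRel (fun a b : ℚ => a ≤ b) :=
  (PrimrecPred.not (primrec_rat_lt.comp Primrec.snd Primrec.fst)).of_eq fun _ => not_lt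

theorem primrec_rat_max : Primrec₂ (fun a b : ℚ => max a b) :=
  (Primrec.ite (primrec_rat_le.comp Primrec.fst Primrec.snd) Primrec.snd Primrec.fst).of_eq
    fun p => (max_def p.1 p.2).symm

theorem primrec_list_sum : Primrec (List.sum : List ℚ → ℚ) := by
  refine (Primrec.list_foldr (h := fun (_ : List ℚ) (p : ℚ × ℚ) => p.1 + p.2) Primrec.id
    (Primrec.const 0) (primrec_rat_add.comp (Primrec.fst.comp Primrec.snd)
      (Primrec.snd.comp Primrec.snd))).of_eq ?_
  intro l
  induction l with
  | nil => rfl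
  | cons a l ih => simpa using ih

/-! ### Codes of finite objects as encodings -/

/-- The code of an object in the encoding attached to primitive recursive functions. -/
def code {α : Type*} [Primcodable α] (a : α) : ℕ := encode a

/-- The partial inverse of `code`. -/
def uncode (α : Type*) [Primcodable α] (n : ℕ) : Option α := decode n

theorem uncode_code {α : Type*} [Primcodable α] (a : α) : uncode α (code a) = some a := encodek a

theorem primrec_code {α : Type*} [Primcodable α] : Primrec (code (α := α)) := Primrec.encode

theorem primrec_uncode {α : Type*} [Primcodable α] : Primrec (uncode α) := Primrec.decode

/-- Both codings of lists obey the same recursion. This identifies the explicit codes of the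
statement with encodings that primitive recursive functions can decode. -/
theorem listCode_map {α β : Type*} [Primcodable α] {f : β → ℕ} {g : β → α}
    (h : ∀ b, f b = code (g b)) (l : List β) :
    listCode (l.map f) = code (α := List α) (l.map g) := by
  induction l with
  | nil => rfl
  | cons a l ih =>
    have h1 : listCode (f a :: l.map f) = (Nat.pair (f a) (listCode (l.map f))).succ := rfl
    have h2 : code (g a :: l.map g) = (Nat.pair (code (g a)) (code (l.map g))).succ := rfl
    rw [List.map_cons, List.map_cons, h1, h2, ← h]
    exact congrArg (fun k => (Nat.pair (f a) k).succ) ih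

theorem intervalsCode_eq (l : List (ℚ × ℚ)) :
    intervalsCode l = code (α := List (ℚ × ℚ)) l := by
  simpa using! listCode_map (α := ℚ × ℚ) (g := id) (fun _ => rfl) l

theorem boxesCode_eq (l : List (List (ℚ × ℚ))) :
    boxesCode l = code (α := List (List (ℚ × ℚ))) l := by
  simpa using! listCode_map (g := id) intervalsCode_eq l

theorem matrixCode_eq {m k : ℕ} (C : Matrix (Fin m) (Fin k) ℚ) :
    matrixCode C = code (α := List (List ℚ))
      (List.ofFn fun i => List.ofFn fun j => C i j) := by
  have h (i : Fin m) : listCode (List.ofFn fun j => ratCode (C i j)) =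
      code (α := List ℚ) (List.ofFn fun j => C i j) := by
    simpa [List.map_ofFn] using! listCode_map (α := ℚ) (f := ratCode) (g := id) (fun _ => rfl)
      (List.ofFn fun j => C i j)
  have := listCode_map h (List.finRange m)
  simpa [List.ofFn_eq_map, matrixCode] using this

theorem termsCode_eq {k : ℕ} (L : List ((Fin k → ℕ) × ℚ)) :
    termsCode L = code (α := List (List ℕ × ℚ))
      (L.map fun t => (List.ofFn t.1, t.2)) :=
  listCode_map (α := List ℕ × ℚ) (β := (Fin k → ℕ) × ℚ)
    (f := fun t => Nat.pair (listCode (List.ofFn t.1)) (ratCode t.2)) (fun _ => rfl) L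

/-! ### Polynomials as lists of words with coefficients -/

/-- A polynomial presented by a list of terms, a monomial being a word in the indices of the
variables. -/
abbrev WordPoly := List (List ℕ × ℚ)

namespace WordPoly

/-- The value of a polynomial at a point of `ℝ^k`. -/
noncomputable def eval {k : ℕ} (x : Fin k → ℝ) (p : WordPoly) : ℝ :=
  (p.map fun t => (t.2 : ℝ) * ∏ i : Fin k, x i ^ t.1.count (i : ℕ)).sum

def one : WordPoly := [([], 1)]

/-- Multiplying monomials is concatenating words, an operation that does not depend on the number of
variables. -/
def mul (p q : WordPoly) : WordPoly :=
  p.flatMap fun s => q.map fun t => (s.1 ++ t.1, s.2 * t.2)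

def oneSub (p : WordPoly) : WordPoly := one ++ p.map fun t => (t.1, -t.2)

def pow (p : WordPoly) (n : ℕ) : WordPoly := (mul p)^[n] one

def prod (l : List WordPoly) : WordPoly := l.foldr mul one

variable {k : ℕ} (x : Fin k → ℝ)

theorem eval_append (p q : WordPoly) : eval x (p ++ q) = eval x p + eval x q := by
  simp [eval]

theorem eval_one : eval x one = 1 := by simp [eval, one]

theorem eval_mul (p q : WordPoly) : eval x (mul p q) = eval x p * eval x q := by
  induction p with
  | nil => simp [eval, mul]
  | cons s p ih =>
    have h : mul (s :: p) q = (q.map fun t => (s.1 ++ t.1, s.2 * t.2)) ++ mul p q := rfl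
    have h' : eval x (s :: p) = eval x [s] + eval x p := eval_append x [s] p
    rw [h, eval_append, ih, h', add_mul]
    congr 1
    simp only [eval, List.map_map, List.map_cons, List.map_nil, List.sum_cons, List.sum_nil,
      add_zero, ← List.sum_map_mul_left]
    congr 1
    refine List.map_congr_left fun t _ => ?_
    simp only [Function.comp, List.count_append, pow_add, Finset.prod_mul_distrib, Rat.cast_mul]
    ring

theorem eval_oneSub (p : WordPoly) : eval x (oneSub p) = 1 - eval x p := by
  rw [oneSub, eval_append, eval_one, sub_eq_add_neg]
  congr 1
  induction p with
  | nil => simp [eval]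
  | cons s p ih =>
    simp only [eval, List.map_map, List.map_cons, List.sum_cons] at ih ⊢
    rw [ih]
    push_cast
    ring

theorem eval_pow (p : WordPoly) (n : ℕ) : eval x (pow p n) = eval x p ^ n := by
  induction n with
  | zero => exact eval_one x
  | succ n ih => rw [pow, Function.iterate_succ_apply', eval_mul, ← pow, ih, pow_succ']

theorem eval_prod (l : List WordPoly) : eval x (prod l) = (l.map (eval x)).prod := by
  induction l with
  | nil => exact eval_one x
  | cons p l ih => rw [List.map_cons, List.prod_cons, ← ih, ← eval_mul]; rfl

/-- The linear polynomial `a + b x_j`. -/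
def linear (j : ℕ) (a b : ℚ) : WordPoly := [([], a), ([j], b)]

theorem eval_linear (j : Fin k) (a b : ℚ) : eval x (linear j a b) = a + b * x j := by
  have : ∏ i : Fin k, x i ^ List.count (i : ℕ) [(j : ℕ)] = x j := by
    rw [Finset.prod_eq_single j] <;> simp +contextual [Fin.ext_iff, eq_comm]
  simp [eval, linear, this]

/-! ### Primitive recursiveness of the operations on polynomials. -/

theorem primrec_append : Primrec₂ (fun p q : WordPoly => p ++ q) := Primrec.list_append

theorem primrec_mul : Primrec₂ mul := by
  refine Primrec.list_flatMap Primrec.fst (Primrec.list_map (Primrec.snd.comp Primrec.fst)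
    (Primrec.pair ?_ ?_))
  · exact Primrec.list_append.comp (Primrec.fst.comp (Primrec.snd.comp Primrec.fst))
      (Primrec.fst.comp Primrec.snd)
  · exact primrec_rat_mul.comp (Primrec.snd.comp (Primrec.snd.comp Primrec.fst))
      (Primrec.snd.comp Primrec.snd)

theorem primrec_oneSub : Primrec oneSub :=
  primrec_append.comp (Primrec.const one) (Primrec.list_map Primrec.id
    (Primrec.pair (Primrec.fst.comp Primrec.snd)
      (primrec_rat_neg.comp (Primrec.snd.comp Primrec.snd))))

theorem primrec_pow : Primrec₂ pow :=
  Primrec.nat_iterate Primrec.snd (Primrec.const one)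
    (primrec_mul.comp (Primrec.fst.comp Primrec.fst) Primrec.snd)

theorem primrec_prod : Primrec prod :=
  Primrec.list_foldr (h := fun _ p => mul p.1 p.2) Primrec.id (Primrec.const one)
    (primrec_mul.comp (Primrec.fst.comp Primrec.snd) (Primrec.snd.comp Primrec.snd))

theorem primrec_linear {α : Type*} [Primcodable α] {f : α → ℕ} {g h : α → ℚ} (hf : Primrec f)
    (hg : Primrec g) (hh : Primrec h) : Primrec fun a => linear (f a) (g a) (h a) :=
  Primrec.list_cons.comp (Primrec.pair (Primrec.const []) hg)
    (Primrec.list_cons.comp (Primrec.pair (Primrec.list_cons.comp hf (Primrec.const [])) hh)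
      (Primrec.const []))

/-! ### Approximations of indicators -/

/-- The polynomial `1 - (1 - p ^ N) ^ M`. -/
def steep (N M : ℕ) (p : WordPoly) : WordPoly := oneSub (pow (oneSub (pow p N)) M)

/-- A scaling factor that moves differences of `a` and points of the unit interval into
`[-1/2, 1/2]`. -/
def scale (a : ℚ) : ℚ := ((1 : ℤ) : ℚ) / (2 * (1 + a.num.natAbs) : ℕ)

/-- On the unit interval the two linear polynomials have values in `[0,1]`, and they exceed `1/2`
exactly to the right of `I.1` and to the left of `I.2`, respectively. -/
def boxFactor (N M j : ℕ) (I : ℚ × ℚ) : WordPoly :=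
  mul (steep N M (linear j (1 / 2 - I.1 * scale I.1) (scale I.1)))
    (steep N M (linear j (1 / 2 + I.2 * scale I.2) (-scale I.2)))

def boxApprox (N M : ℕ) (B : List (ℚ × ℚ)) : WordPoly :=
  prod ((List.range B.length).map fun j => boxFactor N M j (B.getD j (0, 0)))

/-- The number of boxes enters the exponent so that each box errs by at most `2 ^ (-(n + s.length))`
at points outside it; off the union, the total error is then at most the subtracted `2 ^ (-n)`. -/
def unionApprox (n : ℕ) (s : List (List (ℚ × ℚ))) : WordPoly :=
  oneSub (prod (s.map fun B => oneSub (boxApprox (n * n + n + s.length) (2 ^ (n * n)) B))) ++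
    [([], -(((1 : ℤ) : ℚ) / (2 ^ n : ℕ)))]

theorem primrec_steep {α : Type*} [Primcodable α] {f g : α → ℕ} {h : α → WordPoly} (hf : Primrec f)
    (hg : Primrec g) (hh : Primrec h) : Primrec fun a => steep (f a) (g a) (h a) :=
  primrec_oneSub.comp (primrec_pow.comp (primrec_oneSub.comp (primrec_pow.comp hh hf)) hg)

theorem primrec_scale : Primrec scale :=
  primrec_rat_mk.comp (Primrec.const 1) (Primrec.nat_mul.comp (Primrec.const 2)
    (Primrec.nat_add.comp (Primrec.const 1) (primrec_int_natAbs.comp primrec_rat_num)))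

theorem primrec_boxFactor {α : Type*} [Primcodable α] {f g h : α → ℕ} {u : α → ℚ × ℚ}
    (hf : Primrec f) (hg : Primrec g) (hh : Primrec h) (hu : Primrec u) :
    Primrec fun a => boxFactor (f a) (g a) (h a) (u a) := by
  have h1 := Primrec.fst.comp hu
  have h2 := Primrec.snd.comp hu
  have s1 := primrec_scale.comp h1
  have s2 := primrec_scale.comp h2
  exact primrec_mul.comp
    (primrec_steep hf hg (primrec_linear hh
      (primrec_rat_sub.comp (Primrec.const (1 / 2)) (primrec_rat_mul.comp h1 s1)) s1))
    (primrec_steep hf hg (primrec_linear hh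
      (primrec_rat_add.comp (Primrec.const (1 / 2)) (primrec_rat_mul.comp h2 s2))
      (primrec_rat_neg.comp s2)))

theorem primrec_boxApprox {α : Type*} [Primcodable α] {f g : α → ℕ} {u : α → List (ℚ × ℚ)}
    (hf : Primrec f) (hg : Primrec g) (hu : Primrec u) :
    Primrec fun a => boxApprox (f a) (g a) (u a) :=
  primrec_prod.comp (Primrec.list_map (Primrec.list_range.comp (Primrec.list_length.comp hu))
    (primrec_boxFactor (hf.comp Primrec.fst) (hg.comp Primrec.fst) Primrec.snd
      ((Primrec.list_getD (0, 0)).comp (hu.comp Primrec.fst) Primrec.snd)))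

theorem primrec_nat_pow : Primrec₂ (fun a b : ℕ => a ^ b) :=
  Primrec₂.unpaired'.1 Nat.Primrec.pow

theorem primrec_unionApprox : Primrec₂ unionApprox := by
  have hn : Primrec (Prod.fst : ℕ × List (List (ℚ × ℚ)) → ℕ) := Primrec.fst
  have hnn := Primrec.nat_mul.comp hn hn
  refine primrec_append.comp (primrec_oneSub.comp (primrec_prod.comp (Primrec.list_map Primrec.snd
    (primrec_oneSub.comp (primrec_boxApprox
      ((Primrec.nat_add.comp (Primrec.nat_add.comp hnn hn)
        (Primrec.list_length.comp Primrec.snd)).comp Primrec.fst)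
      ((primrec_nat_pow.comp (Primrec.const 2) hnn).comp Primrec.fst) Primrec.snd)))))
    (Primrec.list_cons.comp (Primrec.pair (Primrec.const []) (primrec_rat_neg.comp
      (primrec_rat_mk.comp (Primrec.const 1) (primrec_nat_pow.comp (Primrec.const 2) hn))))
      (Primrec.const []))

theorem eval_steep (N M : ℕ) (p : WordPoly) :
    eval x (steep N M p) = 1 - (1 - eval x p ^ N) ^ M := by
  simp [steep, eval_oneSub, eval_pow]

end WordPoly

/-! ### Estimates for `1 - (1 - g ^ N) ^ M` on the unit interval. -/

theorem steep_mem_Icc {g : ℝ} (hg : g ∈ Set.Icc (0 : ℝ) 1) (N M : ℕ) :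
    1 - (1 - g ^ N) ^ M ∈ Set.Icc (0 : ℝ) 1 := by
  have h1 : g ^ N ≤ 1 := pow_le_one₀ hg.1 hg.2
  have h0 : 0 ≤ g ^ N := pow_nonneg hg.1 N
  have h2 : (1 - g ^ N) ^ M ≤ 1 := pow_le_one₀ (by linarith) (by linarith)
  have h3 : 0 ≤ (1 - g ^ N) ^ M := pow_nonneg (by linarith) M
  constructor <;> linarith

/-- Bernoulli's inequality bounds the left side by `M * g ^ N`, and `2 ^ (n * n)` cancels the
summand `n * n` of the exponent. -/
theorem steep_le {g : ℝ} (hg : g ∈ Set.Icc (0 : ℝ) (1 / 2)) (n S : ℕ) :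
    1 - (1 - g ^ (n * n + n + S)) ^ 2 ^ (n * n) ≤ (1 / 2) ^ (n + S) := by
  have h1 : g ^ (n * n + n + S) ≤ (1 / 2) ^ (n * n + n + S) := pow_le_pow_left₀ hg.1 hg.2 _
  have h4 : (1 / 2 : ℝ) ^ (n * n + n + S) ≤ 1 := pow_le_one₀ (by norm_num) (by norm_num)
  have h2 := one_add_mul_le_pow (a := -g ^ (n * n + n + S)) (by linarith) (2 ^ (n * n))
  have h3 : (2 : ℝ) ^ (n * n) * (1 / 2) ^ (n * n + n + S) = (1 / 2) ^ (n + S) := by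
    rw [add_assoc, pow_add (1 / 2 : ℝ) (n * n), ← mul_assoc, ← mul_pow]
    norm_num
  have h5 := mul_le_mul_of_nonneg_left h1 (by positivity : (0 : ℝ) ≤ 2 ^ (n * n))
  rw [← sub_eq_add_neg] at h2
  push_cast at h2
  linarith

/-- Since `(1 - g ^ N) ^ M ≤ exp (-M * g ^ N)`, it is enough that `M * g ^ N = g ^ S * ((2 * g) ^ n
* g) ^ n` tends to infinity; once `(2 * g) ^ n ≥ 2 / g`, it is at least `g ^ S * 2 ^ n`. -/
theorem tendsto_steep {g : ℝ} (hg : g ∈ Set.Ioc (1 / 2 : ℝ) 1) (S : ℕ) :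
    Tendsto (fun n : ℕ => 1 - (1 - g ^ (n * n + n + S)) ^ 2 ^ (n * n)) atTop (𝓝 1) := by
  have hg0 : 0 < g := by linarith [hg.1]
  have hM : Tendsto (fun n : ℕ => (2 : ℝ) ^ (n * n) * g ^ (n * n + n + S)) atTop atTop := by
    have h1 : Tendsto (fun n : ℕ => (2 * g) ^ n) atTop atTop :=
      tendsto_pow_atTop_atTop_of_one_lt (by linarith [hg.1])
    have h2 : Tendsto (fun n : ℕ => g ^ S * (2 : ℝ) ^ n) atTop atTop :=
      (tendsto_pow_atTop_atTop_of_one_lt one_lt_two).const_mul_atTop (by positivity)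
    refine tendsto_atTop_mono' _ ?_ h2
    filter_upwards [h1.eventually_ge_atTop (2 / g)] with n hn
    have h3 : 2 ≤ (2 * g) ^ n * g := (div_le_iff₀ hg0).1 hn
    have h4 : (2 : ℝ) ^ n ≤ ((2 * g) ^ n * g) ^ n := pow_le_pow_left₀ (by norm_num) h3 n
    calc g ^ S * 2 ^ n ≤ g ^ S * ((2 * g) ^ n * g) ^ n := by gcongr
      _ = 2 ^ (n * n) * g ^ (n * n + n + S) := by
        rw [mul_pow, ← pow_mul, mul_pow, pow_add, pow_add]; ring
  have h0 : Tendsto (fun n : ℕ => (1 - g ^ (n * n + n + S)) ^ 2 ^ (n * n)) atTop (𝓝 0) := by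
    refine squeeze_zero (fun n => ?_) (fun n => ?_) (Real.tendsto_exp_neg_atTop_nhds_zero.comp hM)
    · have : g ^ (n * n + n + S) ≤ 1 := pow_le_one₀ hg0.le hg.2
      exact pow_nonneg (by linarith) _
    · have : g ^ (n * n + n + S) ≤ 1 := pow_le_one₀ hg0.le hg.2
      refine (pow_le_pow_left₀ (by linarith) (Real.one_sub_le_exp_neg _) _).trans_eq ?_
      rw [← Real.exp_nat_mul]
      simp
  simpa using h0.const_sub 1

namespace WordPoly

variable {k : ℕ} {x : Fin k → ℝ}

theorem scale_pos (a : ℚ) : 0 < (scale a : ℝ) := by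
  rw [scale]; positivity

/-- The absolute value of a rational is at most that of its numerator, so `|t - a| ≤ 1 + |a.num|`.
-/
theorem abs_le_scale (a : ℚ) {t : ℝ} (ht : t ∈ Set.Icc (0 : ℝ) 1) :
    |t - a| * scale a ≤ 1 / 2 := by
  have h1 : |(a : ℝ)| ≤ a.num.natAbs := by
    have hd : (1 : ℝ) ≤ a.den := by exact_mod_cast a.den_pos
    rw [Rat.cast_def, abs_div, Nat.abs_cast, Nat.cast_natAbs, Int.cast_abs]
    exact div_le_self (abs_nonneg _) hd
  have h2 : |t - a| ≤ 1 + a.num.natAbs :=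
    (abs_sub _ _).trans (add_le_add (abs_le.2 ⟨by linarith [ht.1], ht.2⟩) h1)
  have h3 : (0 : ℝ) < 1 + a.num.natAbs := by positivity
  rw [scale]
  push_cast
  rw [mul_one_div, div_le_div_iff₀ (by positivity) (by norm_num)]
  linarith

/-- The value of `boxFactor` at a point with `j`-th coordinate `t`. -/
noncomputable def factorVal (N M : ℕ) (I : ℚ × ℚ) (t : ℝ) : ℝ :=
  (1 - (1 - (1 / 2 + (t - I.1) * scale I.1) ^ N) ^ M) *
    (1 - (1 - (1 / 2 + (I.2 - t) * scale I.2) ^ N) ^ M)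

variable (x) in
theorem eval_boxFactor (N M : ℕ) (j : Fin k) (I : ℚ × ℚ) :
    eval x (boxFactor N M j I) = factorVal N M I (x j) := by
  rw [boxFactor, eval_mul, eval_steep, eval_steep, eval_linear, eval_linear, factorVal]
  push_cast
  ring

variable (x) in
theorem eval_boxApprox (N M : ℕ) (B : Fin k → ℚ × ℚ) :
    eval x (boxApprox N M (List.ofFn B)) = ∏ j, factorVal N M (B j) (x j) := by
  rw [boxApprox, eval_prod, List.map_map, List.length_ofFn]
  change ∏ j ∈ Finset.range k, _ = _
  rw [Finset.prod_range]
  refine Finset.prod_congr rfl fun j _ => ?_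
  simp [eval_boxFactor]

theorem lower_mem {t : ℝ} (ht : t ∈ Set.Icc (0 : ℝ) 1) (a : ℚ) :
    1 / 2 + (t - a) * scale a ∈ Set.Icc (0 : ℝ) 1 := by
  have h := abs_le_scale a ht
  rw [← abs_of_pos (scale_pos a), ← abs_mul, abs_le] at h
  constructor <;> linarith [h.1, h.2]

theorem upper_mem {t : ℝ} (ht : t ∈ Set.Icc (0 : ℝ) 1) (b : ℚ) :
    1 / 2 + (b - t) * scale b ∈ Set.Icc (0 : ℝ) 1 := by
  have h := lower_mem ht b
  constructor <;> nlinarith [h.1, h.2]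

theorem factorVal_mem (N M : ℕ) (I : ℚ × ℚ) {t : ℝ} (ht : t ∈ Set.Icc (0 : ℝ) 1) :
    factorVal N M I t ∈ Set.Icc (0 : ℝ) 1 := by
  have h1 := steep_mem_Icc (lower_mem ht I.1) N M
  have h2 := steep_mem_Icc (upper_mem ht I.2) N M
  exact ⟨mul_nonneg h1.1 h2.1, mul_le_one₀ h1.2 h2.1 h2.2⟩

/-- Outside the interval one of the two bases is at most `1/2`, while the other factor is at most
`1`. An interval with reversed endpoints needs no separate case. -/
theorem factorVal_le (n S : ℕ) (I : ℚ × ℚ) {t : ℝ} (ht : t ∈ Set.Icc (0 : ℝ) 1)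
    (hI : t ∉ Set.Ioo (I.1 : ℝ) I.2) :
    factorVal (n * n + n + S) (2 ^ (n * n)) I t ≤ (1 / 2) ^ (n + S) := by
  have h1 := steep_mem_Icc (lower_mem ht I.1) (n * n + n + S) (2 ^ (n * n))
  have h2 := steep_mem_Icc (upper_mem ht I.2) (n * n + n + S) (2 ^ (n * n))
  rcases le_or_gt t I.1 with h | h
  · refine (mul_le_of_le_one_right h1.1 h2.2).trans (steep_le ⟨(lower_mem ht I.1).1, ?_⟩ n S)
    nlinarith [scale_pos I.1]
  · have h' : (I.2 : ℝ) ≤ t := not_lt.1 fun h' => hI ⟨h, h'⟩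
    refine (mul_le_of_le_one_left h2.1 h1.2).trans (steep_le ⟨(upper_mem ht I.2).1, ?_⟩ n S)
    nlinarith [scale_pos I.2]

theorem tendsto_factorVal (S : ℕ) (I : ℚ × ℚ) {t : ℝ} (ht : t ∈ Set.Icc (0 : ℝ) 1)
    (hI : t ∈ Set.Ioo (I.1 : ℝ) I.2) :
    Tendsto (fun n : ℕ => factorVal (n * n + n + S) (2 ^ (n * n)) I t) atTop (𝓝 1) := by
  have h1 := tendsto_steep (g := 1 / 2 + (t - I.1) * scale I.1)
    ⟨by linarith [mul_pos (sub_pos.2 hI.1) (scale_pos I.1)], (lower_mem ht I.1).2⟩ S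
  have h2 := tendsto_steep (g := 1 / 2 + (I.2 - t) * scale I.2)
    ⟨by linarith [mul_pos (sub_pos.2 hI.2) (scale_pos I.2)], (upper_mem ht I.2).2⟩ S
  simpa [factorVal] using h1.mul h2

/-- The value of the approximation of the indicator of a box. -/
noncomputable def boxVal (x : Fin k → ℝ) (n S : ℕ) (B : Fin k → ℚ × ℚ) : ℝ :=
  ∏ j, factorVal (n * n + n + S) (2 ^ (n * n)) (B j) (x j)

theorem boxVal_mem (hx : ∀ j, x j ∈ Set.Icc (0 : ℝ) 1) (n S : ℕ) (B : Fin k → ℚ × ℚ) :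
    boxVal x n S B ∈ Set.Icc (0 : ℝ) 1 :=
  ⟨Finset.prod_nonneg fun j _ => (factorVal_mem _ _ _ (hx j)).1,
    Finset.prod_le_one (fun j _ => (factorVal_mem _ _ _ (hx j)).1)
      fun j _ => (factorVal_mem _ _ _ (hx j)).2⟩

theorem boxVal_le (hx : ∀ j, x j ∈ Set.Icc (0 : ℝ) 1) (n S : ℕ) (B : Fin k → ℚ × ℚ)
    (hB : x ∉ Set.univ.pi fun j => Set.Ioo ((B j).1 : ℝ) (B j).2) :
    boxVal x n S B ≤ (1 / 2) ^ (n + S) := by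
  obtain ⟨j, hj⟩ : ∃ j, x j ∉ Set.Ioo ((B j).1 : ℝ) (B j).2 := by
    by_contra! h
    exact hB fun j _ => h j
  rw [boxVal, ← Finset.mul_prod_erase _ _ (Finset.mem_univ j)]
  refine (mul_le_of_le_one_right (factorVal_mem _ _ _ (hx j)).1 ?_).trans
    (factorVal_le n S _ (hx j) hj)
  exact Finset.prod_le_one (fun j _ => (factorVal_mem _ _ _ (hx j)).1)
      fun j _ => (factorVal_mem _ _ _ (hx j)).2

theorem tendsto_boxVal (hx : ∀ j, x j ∈ Set.Icc (0 : ℝ) 1) (S : ℕ) (B : Fin k → ℚ × ℚ)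
    (hB : x ∈ Set.univ.pi fun j => Set.Ioo ((B j).1 : ℝ) (B j).2) :
    Tendsto (fun n => boxVal x n S B) atTop (𝓝 1) := by
  have := tendsto_finsetProd (Finset.univ : Finset (Fin k)) fun j _ =>
    tendsto_factorVal S (B j) (hx j) (hB j (Set.mem_univ j))
  simpa [boxVal] using this

theorem prod_one_sub_mem {α : Type*} {f : α → ℝ} (hf : ∀ a, f a ∈ Set.Icc (0 : ℝ) 1) (s : List α) :
    (s.map fun a => 1 - f a).prod ∈ Set.Icc (0 : ℝ) 1 := by
  induction s with
  | nil => simp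
  | cons a s ih =>
    simp only [List.map_cons, List.prod_cons]
    exact ⟨mul_nonneg (by linarith [(hf a).2]) ih.1,
      mul_le_one₀ (by linarith [(hf a).1]) ih.1 ih.2⟩

/-- A union bound for functions with values in `[0,1]` in place of indicators. -/
theorem one_sub_prod_le {α : Type*} {f : α → ℝ} (hf : ∀ a, f a ∈ Set.Icc (0 : ℝ) 1) {ε : ℝ}
    (s : List α) (hs : ∀ a ∈ s, f a ≤ ε) :
    1 - (s.map fun a => 1 - f a).prod ≤ s.length * ε := by
  induction s with
  | nil => simp
  | cons a s ih =>
    have h1 := ih fun b hb => hs b (List.mem_cons_of_mem _ hb)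
    have h2 := hs a List.mem_cons_self
    have h3 := prod_one_sub_mem hf s
    simp only [List.map_cons, List.prod_cons, List.length_cons]
    push_cast
    nlinarith [(hf a).1, (hf a).2, h3.1, h3.2]

theorem prod_one_sub_le {α : Type*} {f : α → ℝ} (hf : ∀ a, f a ∈ Set.Icc (0 : ℝ) 1) {s : List α}
    {a : α} (ha : a ∈ s) : (s.map fun a => 1 - f a).prod ≤ 1 - f a := by
  induction s with
  | nil => simp at ha
  | cons b s ih =>
    have h3 := prod_one_sub_mem hf s
    simp only [List.map_cons, List.prod_cons]
    rcases List.mem_cons.1 ha with rfl | h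
    · exact mul_le_of_le_one_right (by linarith [(hf a).2]) h3.2
    · exact (mul_le_of_le_one_left h3.1 (by linarith [(hf b).1])).trans (ih h)

variable (x) in
theorem eval_unionApprox (n : ℕ) (s : List (Fin k → ℚ × ℚ)) :
    eval x (unionApprox n (s.map List.ofFn)) =
      1 - (s.map fun B => 1 - boxVal x n s.length B).prod - (1 / 2) ^ n := by
  rw [unionApprox, eval_append, eval_oneSub, eval_prod, List.map_map, List.map_map, sub_eq_add_neg]
  congr 1
  · congr 2
    rw [List.length_map]
    congr 1
    refine List.map_congr_left fun B _ => ?_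
    simp [eval_oneSub, eval_boxApprox, boxVal]
  · simp [eval]

theorem mem_boxUnion {s : List (Fin k → ℚ × ℚ)} :
    x ∈ boxUnion s ↔ ∃ B ∈ s, x ∈ Set.univ.pi fun j => Set.Ioo ((B j).1 : ℝ) (B j).2 := by
  simp [boxUnion]

theorem one_sub_prod_boxVal_le (hx : ∀ j, x j ∈ Set.Icc (0 : ℝ) 1) (n : ℕ)
    {s : List (Fin k → ℚ × ℚ)} (hs : x ∉ boxUnion s) :
    1 - (s.map fun B => 1 - boxVal x n s.length B).prod ≤ (1 / 2) ^ n := by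
  rw [mem_boxUnion] at hs
  push Not at hs
  refine (one_sub_prod_le (boxVal_mem hx n s.length) s
    fun B hB => boxVal_le hx n s.length B (hs B hB)).trans ?_
  have h : (s.length : ℝ) ≤ 2 ^ s.length := by exact_mod_cast Nat.lt_two_pow_self.le
  calc (s.length : ℝ) * (1 / 2) ^ (n + s.length)
      ≤ 2 ^ s.length * (1 / 2) ^ (n + s.length) := by gcongr
    _ = (1 / 2) ^ n := by
      rw [add_comm, pow_add, ← mul_assoc, ← mul_pow]
      norm_num

theorem eval_unionApprox_bounds (hx : ∀ j, x j ∈ Set.Icc (0 : ℝ) 1) (n : ℕ)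
    (s : List (Fin k → ℚ × ℚ)) :
    -1 ≤ eval x (unionApprox n (s.map List.ofFn)) ∧
      eval x (unionApprox n (s.map List.ofFn)) ≤ (boxUnion s).indicator (fun _ => (1 : ℝ)) x := by
  rw [eval_unionApprox]
  have h := prod_one_sub_mem (boxVal_mem hx n s.length) s
  have h1 : (1 / 2 : ℝ) ^ n ≤ 1 := pow_le_one₀ (by norm_num) (by norm_num)
  have h0 : (0 : ℝ) ≤ (1 / 2) ^ n := by positivity
  refine ⟨by linarith [h.2], ?_⟩
  by_cases hs : x ∈ boxUnion s
  · rw [Set.indicator_of_mem hs]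
    linarith [h.1]
  · rw [Set.indicator_of_notMem hs]
    linarith [one_sub_prod_boxVal_le hx n hs]

theorem tendsto_eval_unionApprox (hx : ∀ j, x j ∈ Set.Icc (0 : ℝ) 1) (s : List (Fin k → ℚ × ℚ)) :
    Tendsto (fun n => eval x (unionApprox n (s.map List.ofFn))) atTop
      (𝓝 ((boxUnion s).indicator (fun _ => (1 : ℝ)) x)) := by
  simp only [eval_unionApprox]
  have hp : Tendsto (fun n : ℕ => (1 / 2 : ℝ) ^ n) atTop (𝓝 0) :=
    tendsto_pow_atTop_nhds_zero_of_lt_one (by norm_num) (by norm_num)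
  by_cases hs : x ∈ boxUnion s
  · obtain ⟨B, hB, hxB⟩ := mem_boxUnion.1 hs
    rw [Set.indicator_of_mem hs]
    have h1 : Tendsto (fun n => (s.map fun B => 1 - boxVal x n s.length B).prod) atTop (𝓝 0) := by
      refine squeeze_zero (fun n => (prod_one_sub_mem (boxVal_mem hx n s.length) s).1)
        (fun n => prod_one_sub_le (boxVal_mem hx n s.length) hB) ?_
      simpa using (tendsto_boxVal hx s.length B hxB).const_sub 1
    simpa using (h1.const_sub 1).sub hp
  · rw [Set.indicator_of_notMem hs]
    have h1 : Tendsto (fun n => 1 - (s.map fun B => 1 - boxVal x n s.length B).prod) atTop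
        (𝓝 0) :=
      squeeze_zero
        (fun n => sub_nonneg.2 (prod_one_sub_mem (boxVal_mem hx n s.length) s).2)
        (fun n => one_sub_prod_boxVal_le hx n hs) hp
    simpa using h1.sub hp

/-! ### Exponent vectors -/

/-- The terms of a polynomial in `k` variables with exponent vectors in place of words. -/
def toTerms (k : ℕ) (p : WordPoly) : List ((Fin k → ℕ) × ℚ) :=
  p.map fun t => (fun i => t.1.count (i : ℕ), t.2)

/-- The same terms, with exponent vectors given as lists. -/
def exponents (k : ℕ) (p : WordPoly) : List (List ℕ × ℚ) :=
  p.map fun t => ((List.range k).map fun i => t.1.count i, t.2)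

theorem termsCode_toTerms (k : ℕ) (p : WordPoly) :
    termsCode (toTerms k p) = code (exponents k p) := by
  refine (termsCode_eq _).trans (congrArg _ ?_)
  rw [toTerms, List.map_map]
  refine List.map_congr_left fun t _ => ?_
  simp only [Function.comp, Prod.mk.injEq, and_true]
  refine List.ext_getElem (by simp) fun i h1 h2 => by simp

theorem primrec_count : Primrec₂ (fun (l : List ℕ) (i : ℕ) => l.count i) := by
  refine (Primrec.list_length.comp (PrimrecRel.listFilter (R := fun a b : ℕ => a = b)
    Primrec.eq)).of_eq ?_
  rintro ⟨l, i⟩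
  dsimp only
  rw [List.count_eq_length_filter]
  congr 2

theorem primrec_exponents : Primrec₂ exponents :=
  Primrec.list_map Primrec.snd (Primrec.pair
    (Primrec.list_map (Primrec.list_range.comp (Primrec.fst.comp Primrec.fst))
      (primrec_count.comp (Primrec.fst.comp (Primrec.snd.comp Primrec.fst)) Primrec.snd))
    (Primrec.snd.comp Primrec.snd))

variable (x) in
theorem aeval_termsPoly (L : List ((Fin k → ℕ) × ℚ)) :
    MvPolynomial.aeval x (termsPoly L) = (L.map fun t => (t.2 : ℝ) * ∏ i, x i ^ t.1 i).sum := by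
  rw [termsPoly, map_list_sum, List.map_map]
  congr 1
  refine List.map_congr_left fun t _ => ?_
  simp [MvPolynomial.aeval_monomial, Finsupp.prod_fintype]

variable (x) in
theorem aeval_toTerms (p : WordPoly) :
    MvPolynomial.aeval x (termsPoly (toTerms k p)) = eval x p := by
  rw [aeval_termsPoly, toTerms, List.map_map]
  rfl

end WordPoly

open WordPoly in
theorem exists_isApproximatingArray :
    ∃ p : (k : ℕ) → ℕ → List (Fin k → ℚ × ℚ) → MvPolynomial (Fin k) ℚ,
      IsApproximatingArray p := by
  refine ⟨fun k n s => termsPoly (toTerms k (unionApprox n (s.map List.ofFn))), ?_, ?_, ?_⟩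
  -- The default `[]` is never reached on codes of lists of boxes, the only inputs that matter.
  · refine ⟨fun c => code (exponents c.unpair.2.unpair.1 (unionApprox c.unpair.1
      ((uncode (List (List (ℚ × ℚ))) c.unpair.2.unpair.2).getD []))), ?_, ?_⟩
    · have h1 := Primrec.fst.comp Primrec.unpair
      have h2 := Primrec.snd.comp Primrec.unpair
      have h3 : Primrec fun c : ℕ =>
          (uncode (List (List (ℚ × ℚ))) c.unpair.2.unpair.2).getD [] :=
        Primrec.option_getD.comp (primrec_uncode.comp (h2.comp h2)) (Primrec.const [])
      have h4 := primrec_unionApprox.comp h1 h3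
      have h5 := primrec_exponents.comp (h1.comp h2) h4
      exact (primrec_code.comp h5).to_comp
    · intro k _ n s
      refine ⟨_, rfl, ?_⟩
      rw [termsCode_toTerms, boxesCode_eq]
      simp [uncode_code]
  · intro k _ n s x hx
    rw [aeval_toTerms]
    exact eval_unionApprox_bounds hx n s
  · intro k _ s x hx
    simp only [aeval_toTerms]
    exact tendsto_eval_unionApprox hx s

/-! ### Oracle programs for computable functions -/

/-- A derivation in `Nat.Partrec` is itself a program that makes no query. -/
theorem exists_program_of_partrec {f : ℕ →. ℕ} (hf : Nat.Partrec f) :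
    ∃ e : OracleProgram, ∀ A, e.eval A = f := by
  induction hf with
  | zero => exact ⟨.zero, fun _ => rfl⟩
  | succ => exact ⟨.succ, fun _ => rfl⟩
  | left => exact ⟨.left, fun _ => rfl⟩
  | right => exact ⟨.right, fun _ => rfl⟩
  | pair _ _ ihf ihg =>
    obtain ⟨e, he⟩ := ihf
    obtain ⟨e', he'⟩ := ihg
    exact ⟨.pair e e', fun A => by simp only [OracleProgram.eval, he, he']; rfl⟩
  | comp _ _ ihf ihg =>
    obtain ⟨e, he⟩ := ihf
    obtain ⟨e', he'⟩ := ihg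
    exact ⟨.comp e e', fun A => by simp only [OracleProgram.eval, he, he']; rfl⟩
  | prec _ _ ihf ihg =>
    obtain ⟨e, he⟩ := ihf
    obtain ⟨e', he'⟩ := ihg
    exact ⟨.prec e e', fun A => by simp only [OracleProgram.eval, he, he']; rfl⟩
  | rfind _ ihf =>
    obtain ⟨e, he⟩ := ihf
    exact ⟨.rfind e, fun A => by simp only [OracleProgram.eval, he]; rfl⟩

/-- A total function is computed by one program, uniformly in the oracle. -/
def OracleComputable (F : Set ℕ → ℕ → ℕ) : Prop :=
  ∃ e : OracleProgram, ∀ A n, e.eval A n = Part.some (F A n)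

namespace OracleComputable

theorem of_computable {f : ℕ → ℕ} (hf : Computable f) : OracleComputable fun _ => f := by
  obtain ⟨e, he⟩ := exists_program_of_partrec (Partrec.nat_iff.1 hf.partrec)
  exact ⟨e, fun A n => by rw [he]; rfl⟩

open Classical in
theorem oracle : OracleComputable fun A n => if n ∈ A then 1 else 0 := ⟨.oracle, fun _ _ => rfl⟩

theorem comp {F G : Set ℕ → ℕ → ℕ} (hF : OracleComputable F) (hG : OracleComputable G) :
    OracleComputable fun A n => F A (G A n) := by
  obtain ⟨e, he⟩ := hF
  obtain ⟨e', he'⟩ := hG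
  refine ⟨.comp e e', fun A n => ?_⟩
  simp only [OracleProgram.eval, he']
  exact (Part.bind_some _ _).trans (he A _)

theorem pair {F G : Set ℕ → ℕ → ℕ} (hF : OracleComputable F) (hG : OracleComputable G) :
    OracleComputable fun A n => Nat.pair (F A n) (G A n) := by
  obtain ⟨e, he⟩ := hF
  obtain ⟨e', he'⟩ := hG
  exact ⟨.pair e e', fun A n => by simp [OracleProgram.eval, he, he', Seq.seq]⟩

theorem comp₂ {f : ℕ → ℕ → ℕ} (hf : Computable₂ f) {F G : Set ℕ → ℕ → ℕ}
    (hF : OracleComputable F) (hG : OracleComputable G) :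
    OracleComputable fun A n => f (F A n) (G A n) := by
  have h : Computable fun n : ℕ => f n.unpair.1 n.unpair.2 :=
    hf.comp (Computable.fst.comp Computable.unpair) (Computable.snd.comp Computable.unpair)
  simpa using (of_computable h).comp (hF.pair hG)

theorem prec {F G : Set ℕ → ℕ → ℕ} (hF : OracleComputable F) (hG : OracleComputable G) :
    OracleComputable fun A n => n.unpair.2.rec (F A n.unpair.1)
      fun y i => G A (Nat.pair n.unpair.1 (Nat.pair y i)) := by
  obtain ⟨e, he⟩ := hF
  obtain ⟨e', he'⟩ := hG
  refine ⟨.prec e e', fun A n => ?_⟩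
  simp only [OracleProgram.eval, he]
  generalize n.unpair.2 = m
  induction m with
  | zero => rfl
  | succ m ih =>
    refine (congrArg (Part.bind · _) ih).trans ((Part.bind_some _ _).trans (he' A _))

theorem exists_rfind {F : Set ℕ → ℕ → ℕ} (hF : OracleComputable F) :
    ∃ e : OracleProgram, ∀ A a, (e.eval A a).Dom ↔ ∃ n, F A (Nat.pair a n) = 0 := by
  obtain ⟨e, he⟩ := hF
  refine ⟨.rfind e, fun A a => ?_⟩
  simp only [OracleProgram.eval, he]
  refine Nat.rfind_dom'.trans ?_
  simp

open Classical in
-- A primitive recursion along the list multiplies the `0`-`1` answers of the oracle.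
theorem all_mem {f : ℕ → List ℕ} (hf : Primrec f) :
    OracleComputable fun A n => if ∀ m ∈ f n, m ∈ A then 1 else 0 := by
  have h1 := Primrec.fst.comp Primrec.unpair
  have h2 := Primrec.snd.comp Primrec.unpair
  have hg := (oracle.comp (of_computable ((Primrec.list_getD 0).comp (hf.comp h1)
    (h1.comp h2)).to_comp))
  have hi := of_computable (h2.comp h2).to_comp
  have hloop := (of_computable (Computable.const 1)).prec
    (comp₂ Primrec.nat_mul.to_comp hi hg)
  have hlen := hloop.comp ((of_computable Computable.id).pair
    (of_computable (Primrec.list_length.comp hf).to_comp))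
  convert hlen using 3 with A n
  simp only [Nat.unpair_pair, id]
  -- Invariant of the loop: after `j` rounds the product decides the first `j` entries.
  have h (l : List ℕ) : ∀ j ≤ l.length, (Nat.rec 1
      (fun y i => i * if l.getD y 0 ∈ A then 1 else 0) j : ℕ) =
      if ∀ m ∈ l.take j, m ∈ A then 1 else 0 := by
    intro j
    induction j with
    | zero => simp
    | succ j ih =>
      intro hj
      have hj' : j < l.length := hj
      refine (congrArg (· * if l.getD j 0 ∈ A then 1 else 0) (ih hj'.le)).trans ?_
      simp only [List.take_add_one, List.getElem?_eq_getElem hj', List.getD_eq_getElem?_getD,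
        Option.getD_some, Option.toList_some, List.mem_append, List.mem_singleton, or_imp,
        forall_and, forall_eq]
      split_ifs <;> first | rfl | (exfalso; tauto)
  rw [h _ _ le_rfl, List.take_length]

end OracleComputable

/-- Sets that are c.e. relative to an oracle, uniformly: a search for a witness which satisfies a
computable condition and finitely many membership conditions. -/
theorem exists_search_program {α β : Type*} [Primcodable α] [Primcodable β] {R : α → β → Bool}
    (hR : Computable₂ R) {Q : β → List ℕ} (hQ : Primrec Q) :
    ∃ e : OracleProgram, ∀ A (a : α),
      (e.eval A (code a)).Dom ↔ ∃ b, R a b = true ∧ ∀ m ∈ Q b, m ∈ A := by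
  classical
  have h1 := Primrec.fst.comp Primrec.unpair
  have h2 := Primrec.snd.comp Primrec.unpair
  -- If decoding of the witness fails, the empty list passes the oracle test vacuously, but the
  -- default `false` in `hB` rejects the candidate.
  have hL : Primrec fun n : ℕ => ((uncode β n.unpair.2).map Q).getD [] :=
    Primrec.option_getD.comp (Primrec.option_map (primrec_uncode.comp h2) (hQ.comp Primrec.snd))
      (Primrec.const [])
  have hB : Computable fun n : ℕ => (((uncode α n.unpair.1).bind fun a =>
      (uncode β n.unpair.2).map fun b => R a b).getD false) := by
    refine Computable.option_getD (Computable.option_bind (primrec_uncode.comp h1).to_comp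
      (Computable.option_map ((primrec_uncode.comp h2).to_comp.comp Computable.fst) ?_))
      (Computable.const false)
    exact hR.comp (Computable.snd.comp Computable.fst) Computable.snd
  have hg : Computable fun n : ℕ => bif (((uncode α n.unpair.1).bind fun a =>
      (uncode β n.unpair.2).map fun b => R a b).getD false) then 1 else 0 :=
    Computable.cond hB (Computable.const 1) (Computable.const 0)
  -- The value `1 - a * b` vanishes exactly when both flags are `1`, and unbounded search stops at a
  -- zero.
  have hF := OracleComputable.comp₂ (f := fun a b => 1 - a * b)
    ((Primrec.nat_sub.comp (Primrec.const 1) (Primrec.nat_mul.comp Primrec.fst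
      Primrec.snd)).to_comp) (OracleComputable.of_computable hg) (OracleComputable.all_mem hL)
  obtain ⟨e, he⟩ := hF.exists_rfind
  refine ⟨e, fun A a => (he A (code a)).trans ⟨?_, ?_⟩⟩
  · rintro ⟨n, hn⟩
    simp only [Nat.unpair_pair, uncode_code, Option.bind_some] at hn
    rcases hb : uncode β n with _ | b
    · simp [hb] at hn
    · refine ⟨b, ?_⟩
      simp only [hb, Option.map_some, Option.getD_some] at hn
      by_contra hc
      rw [not_and_or] at hc
      rcases hc with hc | hc
      · simp [hc] at hn
      · simp [hc] at hn
  · rintro ⟨b, hb, hQb⟩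
    refine ⟨code b, ?_⟩
    simp only [Nat.unpair_pair, uncode_code, Option.bind_some, Option.map_some, Option.getD_some,
      hb, if_pos hQb]
    simp

/-! ### Joint probabilities -/

theorem measurableSet_ratOpen (U : List (ℚ × ℚ)) : MeasurableSet (ratOpen U) :=
  (isOpen_biUnion fun _ _ => isOpen_Ioo).measurableSet

/-- The probability is the integral of the conditional probability given `ν`, which is the
`ν^∞`-measure of a finite-dimensional rectangle, a product. -/
theorem map_real_pi_eq_integral {Ω : Type*} [MeasurableSpace Ω] {P : Measure Ω}
    [IsProbabilityMeasure P] {X : ℕ → Ω → ℝ} {ν : Kernel Ω ℝ} [IsMarkovKernel ν]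
    (hX : ∀ i, Measurable (X i)) (hν : IsDirectingMeasure P X ν) {γ : ℕ → Set ℝ}
    (hγ : ∀ i, MeasurableSet (γ i)) (d : ℕ) :
    (P.map fun ω i => X i ω).real {x | ∀ i < d, x i ∈ γ i} =
      ∫ ω, ∏ i ∈ Finset.range d, (ν ω).real (γ i) ∂P := by
  have hXm : Measurable fun ω i => X i ω := measurable_pi_lambda _ hX
  have hA : {x : ℕ → ℝ | ∀ i < d, x i ∈ γ i} = Set.pi (Finset.range d : Finset ℕ) γ := by
    ext x; simp [Set.mem_pi]
  have hAm : MeasurableSet {x : ℕ → ℝ | ∀ i < d, x i ∈ γ i} := by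
    rw [hA]
    exact MeasurableSet.pi (Finset.countable_toSet _) fun i _ => hγ i
  have h := hν _ hAm
  have hm : MeasurableSpace.comap (fun ω => ν ω) inferInstance ≤ ‹MeasurableSpace Ω› :=
    ν.measurable.comap_le
  calc (P.map fun ω i => X i ω).real {x | ∀ i < d, x i ∈ γ i}
      = P.real ((fun ω i => X i ω) ⁻¹' {x | ∀ i < d, x i ∈ γ i}) :=
        map_measureReal_apply hXm hAm
    _ = ∫ ω, (((fun ω i => X i ω) ⁻¹' {x | ∀ i < d, x i ∈ γ i}).indicator fun _ => (1 : ℝ)) ω ∂P := by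
        rw [integral_indicator_const _ (hXm hAm)]; simp
    _ = _ := (integral_condExp hm).symm
    _ = _ := integral_congr_ae h
    _ = _ := by
        congr 1 with ω
        rw [hA, measureReal_def, Measure.infinitePi_pi _ (fun i _ => hγ i), ENNReal.toReal_prod]
        rfl

/-! ### Approximation from inside by finite unions of cylinders -/

/-- There are only countably many rational cylinders, so continuity from below along an enumeration
of `T` yields a finite subfamily. -/
theorem exists_list_lt_measureReal (χ : Measure (ℕ → ℝ)) [IsFiniteMeasure χ]
    (T : Set (List (ℚ × ℚ))) {r : ℝ} (hr : r < χ.real (⋃ τ ∈ T, seqCylinder τ)) :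
    ∃ B : List (List (ℚ × ℚ)), (∀ τ ∈ B, τ ∈ T) ∧ r < χ.real (⋃ τ ∈ B, seqCylinder τ) := by
  rcases T.eq_empty_or_nonempty with rfl | hT
  · exact ⟨[], by simp, by simpa using hr⟩
  obtain ⟨f, rfl⟩ := T.to_countable.exists_eq_range hT
  rw [Set.biUnion_range] at hr
  have h := (ENNReal.tendsto_toReal (measure_ne_top χ _)).comp
    (tendsto_measure_iUnion_accumulate (μ := χ) (f := fun n => seqCylinder (f n)))
  obtain ⟨n, hn⟩ := (h.eventually_const_lt hr).exists
  refine ⟨(List.range (n + 1)).map f, by simp, hn.trans_eq ?_⟩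
  rw [Function.comp, measureReal_def]
  congr 2
  ext x
  simp [Set.mem_accumulate]

/-- The cylinders that witness membership in all of the sets named by `pos`. -/
def ContainedCylinder (pos : List (List (ℚ × ℚ))) (τ : List (ℚ × ℚ)) : Prop :=
  τ.length = pos.length + 1 ∧ ∀ i < pos.length, τ.getD i (0, 0) ∈ pos.getD i []

/-- The cylinders that witness non-membership in the closure of one of the sets named by `pos`. -/
def DisjointCylinder (pos : List (List (ℚ × ℚ))) (τ : List (ℚ × ℚ)) : Prop :=
  ∃ i < pos.length, i < τ.length ∧ ∀ I ∈ pos.getD i [],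
    (τ.getD i (0, 0)).2 ≤ I.1 ∨ I.2 ≤ (τ.getD i (0, 0)).1 ∨ I.2 ≤ I.1

theorem mem_seqCylinder {τ : List (ℚ × ℚ)} {x : ℕ → ℝ} :
    x ∈ seqCylinder τ ↔
      ∀ i < τ.length, x i ∈ Set.Ioo ((τ.getD i (0, 0)).1 : ℝ) (τ.getD i (0, 0)).2 := by
  rw [seqCylinder, Set.mem_ofPred_eq, Fin.forall_iff]
  refine forall₂_congr fun i hi => ?_
  simp [List.getElem?_eq_getElem hi]

theorem exists_rat_Ioo (t : ℝ) : ∃ I : ℚ × ℚ, t ∈ Set.Ioo (I.1 : ℝ) I.2 := by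
  obtain ⟨a, ha⟩ := exists_rat_lt t
  obtain ⟨b, hb⟩ := exists_rat_gt t
  exact ⟨(a, b), ha, hb⟩

theorem mem_seqCylinder_map_range {n : ℕ} {g : ℕ → ℚ × ℚ} {x : ℕ → ℝ} :
    x ∈ seqCylinder ((List.range n).map g) ↔ ∀ i < n, x i ∈ Set.Ioo ((g i).1 : ℝ) (g i).2 := by
  rw [mem_seqCylinder]
  simp only [List.length_map, List.length_range]
  refine forall₂_congr fun i hi => ?_
  simp [hi]

theorem biUnion_containedCylinder (pos : List (List (ℚ × ℚ))) :
    ⋃ τ ∈ {τ | ContainedCylinder pos τ}, seqCylinder τ =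
      {x | ∀ i < pos.length, x i ∈ ratOpen (pos.getD i [])} := by
  ext x
  simp only [Set.mem_iUnion, Set.mem_ofPred_eq, exists_prop]
  constructor
  · rintro ⟨τ, ⟨hl, hτ⟩, hx⟩ i hi
    exact Set.mem_biUnion (hτ i hi) (mem_seqCylinder.1 hx i (by omega))
  · intro h
    have h' (i : ℕ) : ∃ I : ℚ × ℚ, x i ∈ Set.Ioo (I.1 : ℝ) I.2 ∧
        (i < pos.length → I ∈ pos.getD i []) := by
      by_cases hi : i < pos.length
      · obtain ⟨I, hI, hx⟩ := Set.mem_iUnion₂.1 (h i hi)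
        exact ⟨I, hx, fun _ => hI⟩
      · obtain ⟨I, hI⟩ := exists_rat_Ioo (x i)
        exact ⟨I, hI, fun h => absurd h hi⟩
    choose g hg hg' using h'
    -- The extra unconstrained coordinate keeps the dimension at least `1` when `pos` is empty, that
    -- is, for a constant monomial.
    refine ⟨(List.range (pos.length + 1)).map g, ⟨by simp, fun i hi => ?_⟩,
      mem_seqCylinder_map_range.2 fun i _ => hg i⟩
    have := hg' i hi
    simpa [hi.trans (Nat.lt_succ_self _)] using this

/-- An open interval that misses an open set also misses its closure, so comparing rational
endpoints suffices. Conversely, a coordinate outside the closure has a rational interval around it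
that avoids the closure. -/
theorem biUnion_disjointCylinder (pos : List (List (ℚ × ℚ))) :
    ⋃ τ ∈ {τ | DisjointCylinder pos τ}, seqCylinder τ =
      {x | ∀ i < pos.length, x i ∈ closure (ratOpen (pos.getD i []))}ᶜ := by
  ext x
  simp only [Set.mem_iUnion, Set.mem_ofPred_eq, exists_prop, Set.mem_compl_iff, not_forall]
  constructor
  · rintro ⟨τ, ⟨i, hi, hiτ, hτ⟩, hx⟩
    refine ⟨i, hi, fun hc => ?_⟩
    have hd : Disjoint (Set.Ioo ((τ.getD i (0, 0)).1 : ℝ) (τ.getD i (0, 0)).2)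
        (ratOpen (pos.getD i [])) := by
      rw [Set.disjoint_left]
      intro t ht hU
      obtain ⟨I, hI, hIt⟩ := Set.mem_iUnion₂.1 hU
      rcases hτ I hI with h | h | h <;> have h' := (Rat.cast_le (K := ℝ)).2 h <;>
        linarith [ht.1, ht.2, hIt.1, hIt.2]
    exact Set.disjoint_left.1 (hd.closure_right isOpen_Ioo) (mem_seqCylinder.1 hx i hiτ) hc
  · rintro ⟨i, hi, hc⟩
    obtain ⟨v, hv, hxv, hsub⟩ := Real.isTopologicalBasis_Ioo_rat.exists_subset_of_mem_open
      (Set.mem_compl hc) isClosed_closure.isOpen_compl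
    simp only [Set.mem_iUnion, Set.mem_singleton_iff, exists_prop] at hv
    obtain ⟨a, b, hab, rfl⟩ := hv
    choose f hf using fun j => exists_rat_Ioo (x j)
    refine ⟨(List.range (i + 1)).map (Function.update f i (a, b)), ⟨i, hi, by simp, ?_⟩,
      mem_seqCylinder_map_range.2 fun j _ => ?_⟩
    · intro I hI
      have hg : ((List.range (i + 1)).map (Function.update f i (a, b))).getD i (0, 0) = (a, b) := by
        simp
      rw [hg]
      -- Otherwise `(a, b)` and `I` are nonempty intervals that overlap, and a rational point common
      -- to both lies in the set that `(a, b)` avoids.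
      by_contra! hcon
      obtain ⟨h1, h2, h3⟩ := hcon
      obtain ⟨t, ht1, ht2⟩ := exists_between (show max a I.1 < min b I.2 from
        max_lt (lt_min hab h2) (lt_min h1 h3))
      have h4 : (t : ℝ) ∈ ratOpen (pos.getD i []) := Set.mem_biUnion hI
        ⟨Rat.cast_lt.2 ((le_max_right _ _).trans_lt ht1),
          Rat.cast_lt.2 (ht2.trans_le (min_le_right _ _))⟩
      exact hsub ⟨Rat.cast_lt.2 ((le_max_left _ _).trans_lt ht1),
          Rat.cast_lt.2 (ht2.trans_le (min_le_left _ _))⟩ (subset_closure h4)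
    · rcases eq_or_ne j i with rfl | hj
      · simpa using hxv
      · simpa [hj] using hf j

/-- The cylinders that bound, from below, the contribution of a monomial with coefficient `c`. -/
def WitnessCylinder (c : ℚ) (pos : List (List (ℚ × ℚ))) (τ : List (ℚ × ℚ)) : Prop :=
  (0 < c ∧ ContainedCylinder pos τ) ∨ (¬ 0 < c ∧ DisjointCylinder pos τ)

theorem WitnessCylinder.ne_nil {c : ℚ} {pos : List (List (ℚ × ℚ))} {τ : List (ℚ × ℚ)}
    (h : WitnessCylinder c pos τ) : τ ≠ [] := by
  rintro rfl
  rcases h with ⟨_, h⟩ | ⟨_, i, _, h, _⟩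
  · simpa using h.1
  · simp at h

/-- The contribution of a monomial with coefficient `c`, as a function of the measure of the union
of the cylinders given by `WitnessCylinder`. -/
def contribution {K : Type*} [Field K] [LinearOrder K] (c r : K) : K :=
  max c 0 * r + max (-c) 0 * (r - 1)

/-- Both coefficients of `r` are nonnegative, so lower bounds for measures give lower bounds for
contributions, whatever the sign of `c`. -/
theorem contribution_mono (c : ℝ) {r s : ℝ} (h : r ≤ s) : contribution c r ≤ contribution c s := by
  have h1 := mul_le_mul_of_nonneg_left h (le_max_right c 0)
  have h2 := mul_le_mul_of_nonneg_left h (le_max_right (-c) 0)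
  unfold contribution
  linarith

/-- If `c` is not positive, the cylinders fill the complement of the closed event, and `r - 1` is
minus the probability of that event. -/
theorem contribution_measureReal (χ : Measure (ℕ → ℝ)) [IsProbabilityMeasure χ] (c : ℚ)
    (pos : List (List (ℚ × ℚ))) :
    contribution (c : ℝ) (χ.real (⋃ τ ∈ {τ | WitnessCylinder c pos τ}, seqCylinder τ)) =
      max (c : ℝ) 0 * χ.real {x | ∀ i < pos.length, x i ∈ ratOpen (pos.getD i [])} -
      max (-c : ℝ) 0 * χ.real {x | ∀ i < pos.length, x i ∈ closure (ratOpen (pos.getD i []))} := by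
  have hm : MeasurableSet {x : ℕ → ℝ | ∀ i < pos.length, x i ∈ closure (ratOpen (pos.getD i []))} := by
    simp only [Set.ofPred_forall]
    exact MeasurableSet.iInter fun i => MeasurableSet.iInter fun _ =>
      measurable_pi_apply i isClosed_closure.measurableSet
  unfold contribution
  by_cases hc : 0 < c
  · have hc' : (0 : ℝ) < c := by exact_mod_cast hc
    simp only [WitnessCylinder, hc, true_and, not_true_eq_false, false_and, or_false,
      biUnion_containedCylinder, max_eq_right (by linarith : (-c : ℝ) ≤ 0)]
    ring
  · have hc' : (c : ℝ) ≤ 0 := by exact_mod_cast not_lt.1 hc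
    simp only [WitnessCylinder, hc, false_and, not_false_eq_true, true_and, false_or,
      biUnion_disjointCylinder, max_eq_right hc', probReal_compl_eq_one_sub hm]
    ring

/-! ### The expectation as a sum of contributions of monomials -/

/-- The sets, repeated according to the exponents, whose joint probability is the expectation of a
monomial. -/
def positions (σ : List (List (ℚ × ℚ))) (a : List ℕ) : List (List (ℚ × ℚ)) :=
  (List.range σ.length).flatMap fun i => (List.range (a.getD i 0)).map fun _ => σ.getD i []

theorem prod_range_positions {k : ℕ} (σ : Fin k → List (ℚ × ℚ)) (a : Fin k → ℕ)
    (F : List (ℚ × ℚ) → ℝ) :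
    ∏ i ∈ Finset.range (positions (List.ofFn σ) (List.ofFn a)).length,
      F ((positions (List.ofFn σ) (List.ofFn a)).getD i []) = ∏ i, F (σ i) ^ a i := by
  rw [Finset.prod_range]
  have h1 := Fin.prod_univ_fun_getElem (positions (List.ofFn σ) (List.ofFn a)) F
  have h2 : ((positions (List.ofFn σ) (List.ofFn a)).map F).prod =
      ((List.range k).map fun i => F ((List.ofFn σ).getD i []) ^ (List.ofFn a).getD i 0).prod := by
    rw [positions, List.flatMap_def, List.map_flatten, List.prod_flatten, List.length_ofFn,
      List.map_map, List.map_map]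
    congr 1
    refine List.map_congr_left fun i _ => ?_
    simp only [Function.comp, List.map_map]
    rw [show F ∘ (fun _ : ℕ => (List.ofFn σ).getD i []) = Function.const ℕ (F ((List.ofFn σ).getD i []))
      from rfl, List.map_const, List.prod_replicate, List.length_range]
  have h3 : ((List.range k).map fun i => F ((List.ofFn σ).getD i []) ^ (List.ofFn a).getD i 0).prod
      = ∏ i ∈ Finset.range k, F ((List.ofFn σ).getD i []) ^ (List.ofFn a).getD i 0 := rfl
  rw [Finset.prod_range] at h3
  rw [h2, h3] at h1
  simpa using h1

/-- The coefficient of a monomial in a list of terms. -/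
def coefficient (L : List (List ℕ × ℚ)) (a : List ℕ) : ℚ :=
  (L.map fun t => if t.1 = a then t.2 else 0).sum

/-- The list of monomials that occur in a list of terms, each with its coefficient. -/
def collect (L : List (List ℕ × ℚ)) : List (List ℕ × ℚ) :=
  (L.map Prod.fst).dedup.map fun a => (a, coefficient L a)

theorem coeff_termsPoly {k : ℕ} (L : List ((Fin k → ℕ) × ℚ)) (a : Fin k →₀ ℕ) :
    (termsPoly L).coeff a = coefficient (L.map fun t => (List.ofFn t.1, t.2)) (List.ofFn a) := by
  induction L with
  | nil => simp [termsPoly, coefficient]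
  | cons t L ih =>
    have h1 : termsPoly (t :: L) =
      MvPolynomial.monomial (Finsupp.equivFunOnFinite.symm t.1) t.2 + termsPoly L := rfl
    have h2 : Finsupp.equivFunOnFinite.symm t.1 = a ↔ List.ofFn t.1 = List.ofFn a := by
      rw [List.ofFn_inj, Equiv.symm_apply_eq]
      rfl
    rw [h1, MvPolynomial.coeff_add, ih, MvPolynomial.coeff_monomial]
    simp only [coefficient, List.map_cons, List.sum_cons, h2]

/-- A list of terms may repeat a monomial, whereas the splitting by sign refers to the true
coefficients; hence terms are collected first. Monomials whose coefficients cancel remain in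
`collect`, which is harmless because `T a 0 = 0`. -/
theorem sum_support_termsPoly {k : ℕ} (L : List ((Fin k → ℕ) × ℚ)) (T : List ℕ → ℚ → ℝ)
    (hT : ∀ a, T a 0 = 0) :
    ∑ a ∈ (termsPoly L).support, T (List.ofFn a) ((termsPoly L).coeff a) =
      ((collect (L.map fun t => (List.ofFn t.1, t.2))).map fun z => T z.1 z.2).sum := by
  classical
  set L' := L.map fun t => (List.ofFn t.1, t.2) with hL'
  let S : List (Fin k →₀ ℕ) := L.map fun t => Finsupp.equivFunOnFinite.symm t.1
  let h : (Fin k →₀ ℕ) → List ℕ := fun a => List.ofFn a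
  have hinj : Function.Injective h := fun a b hab => DFunLike.coe_injective (List.ofFn_injective hab)
  have hS : S.map h = L'.map Prod.fst := by
    simp only [S, hL', List.map_map]
    rfl
  have hsub : (termsPoly L).support ⊆ S.toFinset := by
    intro a ha
    rw [List.mem_toFinset]
    by_contra hn
    refine MvPolynomial.mem_support_iff.1 ha ?_
    rw [coeff_termsPoly, coefficient]
    refine List.sum_eq_zero fun y hy => ?_
    obtain ⟨t, ht, rfl⟩ := List.mem_map.1 hy
    refine if_neg fun heq => hn ?_
    have : h a ∈ S.map h := by
      rw [hS]
      exact List.mem_map.2 ⟨t, ht, heq⟩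
    obtain ⟨b, hb, hab⟩ := List.mem_map.1 this
    exact hinj hab ▸ hb
  rw [Finset.sum_subset hsub fun a _ ha => by
    rw [MvPolynomial.notMem_support_iff.1 ha, hT]]
  rw [show S.toFinset = S.dedup.toFinset by ext; simp, List.sum_toFinset _ S.nodup_dedup, collect, ← hS,
    List.dedup_map_of_injective hinj, List.map_map, List.map_map]
  congr 1
  refine List.map_congr_left fun a _ => ?_
  simp only [Function.comp, coeff_termsPoly]
  rfl

theorem aeval_splitPoly {k : ℕ} (p : MvPolynomial (Fin k) ℚ) (u v : Fin k → ℝ) :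
    MvPolynomial.aeval (Sum.elim u v) (splitPoly p) =
      ∑ a ∈ p.support, (max ((p.coeff a : ℚ) : ℝ) 0 * ∏ i, u i ^ a i -
        max (-((p.coeff a : ℚ) : ℝ)) 0 * ∏ i, v i ^ a i) := by
  rw [splitPoly, map_sub, MvPolynomial.aeval_rename, MvPolynomial.aeval_rename, positivePart,
    negativePart, map_sum, map_sum, ← Finset.sum_sub_distrib]
  refine Finset.sum_congr rfl fun a _ => ?_
  simp [MvPolynomial.aeval_monomial, Finsupp.prod_fintype]

theorem integrable_monomial {Ω : Type*} [MeasurableSpace Ω] {P : Measure Ω} [IsProbabilityMeasure P]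
    (ν : Kernel Ω ℝ) [IsMarkovKernel ν] {k : ℕ} (a : Fin k → ℕ) {γ : Fin k → Set ℝ}
    (hγ : ∀ i, MeasurableSet (γ i)) :
    Integrable (fun ω => ∏ i, (ν ω).real (γ i) ^ a i) P := by
  refine Integrable.of_bound (C := 1) (Measurable.aestronglyMeasurable ?_) (ae_of_all _ fun ω => ?_)
  · exact Finset.measurable_prod _ fun i _ =>
      ((ν.measurable_coe (hγ i)).ennreal_toReal).pow_const _
  · rw [Real.norm_of_nonneg (Finset.prod_nonneg fun i _ => by positivity)]
    exact Finset.prod_le_one (fun i _ => by positivity)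
      fun i _ => pow_le_one₀ measureReal_nonneg measureReal_le_one

/-- The cylinders whose union has the measure that the contribution of a term depends on. -/
def witnessSet (σ : List (List (ℚ × ℚ))) (z : List ℕ × ℚ) : Set (ℕ → ℝ) :=
  ⋃ τ ∈ {τ | WitnessCylinder z.2 (positions σ z.1) τ}, seqCylinder τ

theorem expectedValue_eq {Ω : Type*} [MeasurableSpace Ω] {P : Measure Ω}
    [IsProbabilityMeasure P] {X : ℕ → Ω → ℝ} {ν : Kernel Ω ℝ} [IsMarkovKernel ν]
    (hX : ∀ i, Measurable (X i)) (hν : IsDirectingMeasure P X ν) {k : ℕ}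
    (L : List ((Fin k → ℕ) × ℚ)) (σ : Fin k → List (ℚ × ℚ)) :
    expectedValue P ν (splitPoly (termsPoly L)) σ =
      ((collect (L.map fun t => (List.ofFn t.1, t.2))).map fun z => contribution (z.2 : ℝ)
        ((P.map fun ω i => X i ω).real (witnessSet (List.ofFn σ) z))).sum := by
  have hXm : Measurable fun ω i => X i ω := measurable_pi_lambda _ hX
  have := Measure.isProbabilityMeasure_map (μ := P) hXm.aemeasurable
  have h1 (a : Fin k → ℕ) : Integrable (fun ω => ∏ i, (ν ω).real (ratOpen (σ i)) ^ a i) P :=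
    integrable_monomial ν a fun i => measurableSet_ratOpen _
  have h2 (a : Fin k → ℕ) :
      Integrable (fun ω => ∏ i, (ν ω).real (closure (ratOpen (σ i))) ^ a i) P :=
    integrable_monomial ν a fun i => isClosed_closure.measurableSet
  have h3 (a : Fin k → ℕ) (γ : List (ℚ × ℚ) → Set ℝ) (hγ : ∀ U, MeasurableSet (γ U)) :
      ∫ ω, ∏ i, (ν ω).real (γ (σ i)) ^ a i ∂P = (P.map fun ω i => X i ω).real
        {x | ∀ i < (positions (List.ofFn σ) (List.ofFn a)).length,
          x i ∈ γ ((positions (List.ofFn σ) (List.ofFn a)).getD i [])} := by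
    rw [map_real_pi_eq_integral hX hν (γ := fun i =>
      γ ((positions (List.ofFn σ) (List.ofFn a)).getD i [])) fun i => hγ _]
    congr 1 with ω
    exact (prod_range_positions σ a fun U => (ν ω).real (γ U)).symm
  rw [← sum_support_termsPoly L (fun a c => contribution (c : ℝ)
    ((P.map fun ω i => X i ω).real (witnessSet (List.ofFn σ) (a, c)))) (by simp [contribution]),
    expectedValue]
  simp only [aeval_splitPoly]
  have h4 (c c' : ℝ) (a : Fin k →₀ ℕ) :
      Integrable (fun ω => c * ∏ i, (ν ω).real (ratOpen (σ i)) ^ a i -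
        c' * ∏ i, (ν ω).real (closure (ratOpen (σ i))) ^ a i) P :=
    ((h1 a).const_mul c).sub ((h2 a).const_mul c')
  refine (integral_finsetSum _ fun a _ => h4 _ _ a).trans (Finset.sum_congr rfl fun a _ => ?_)
  rw [integral_sub ((h1 a).const_mul _) ((h2 a).const_mul _), integral_const_mul,
    integral_const_mul, h3 a ratOpen measurableSet_ratOpen,
    h3 a (fun U => closure (ratOpen U)) fun U => isClosed_closure.measurableSet]
  exact (contribution_measureReal _ _ _).symm

/-! ### Witnesses for lower bounds -/

/-- A list of terms, each with a finite list of cylinders and a rational, a lower bound for the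
measure of their union. -/
abbrev Witness := List ((List ℕ × ℚ) × (List (List (ℚ × ℚ)) × ℚ))

/-- A witness shows that the sum of the contributions of the terms `M` exceeds `q`, if the lower
bounds are correct. -/
def Certifies (M : List (List ℕ × ℚ)) (σ : List (List (ℚ × ℚ))) (q : ℚ) (t : Witness) : Prop :=
  t.map Prod.fst = M ∧
    (∀ z ∈ t, ∀ τ ∈ z.2.1, WitnessCylinder z.1.2 (positions σ z.1.1) τ) ∧
    q < (t.map fun z => contribution z.1.2 z.2.2).sum

/-- The codes of the lower bounds in a witness. -/
def queries (t : Witness) : List ℕ := t.map fun z => Nat.pair (code z.2.1) (ratCode z.2.2)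

theorem ratCode_injective : Function.Injective ratCode := fun q r h => by
  have h' : code q = code r := h
  simpa [uncode_code] using congrArg (uncode ℚ) h'

theorem boxesCode_injective : Function.Injective boxesCode := fun B B' h => by
  rw [boxesCode_eq, boxesCode_eq] at h
  simpa [uncode_code] using congrArg (uncode (List (List (ℚ × ℚ)))) h

theorem pair_mem_representation {χ : Measure (ℕ → ℝ)} {B : List (List (ℚ × ℚ))} {r : ℚ} :
    Nat.pair (code B) (ratCode r) ∈ representation χ ↔
      (∀ τ ∈ B, τ ≠ []) ∧ (r : ℝ) < χ.real (⋃ τ ∈ B, seqCylinder τ) := by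
  rw [← boxesCode_eq]
  constructor
  · rintro ⟨B', r', h1, h2, h3⟩
    obtain ⟨hB, hr⟩ := Nat.pair_eq_pair.1 h3
    obtain rfl := boxesCode_injective hB
    obtain rfl := ratCode_injective hr
    exact ⟨h1, h2⟩
  · rintro ⟨h1, h2⟩
    exact ⟨B, r, h1, h2, rfl⟩

theorem cast_contribution (c r : ℚ) :
    ((contribution c r : ℚ) : ℝ) = contribution (c : ℝ) (r : ℝ) := by
  simp [contribution]

/-- The sum is continuous in the values, so rationals close enough to `v z` from below preserve the
strict inequality. -/
theorem exists_rat_lt_sum_contribution {ι : Type*} (M : List ι) (c v : ι → ℝ) {q : ℝ}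
    (hq : q < (M.map fun z => contribution (c z) (v z)).sum) :
    ∃ r : ι → ℚ, (∀ z, (r z : ℝ) < v z) ∧
      q < (M.map fun z => contribution (c z) (r z : ℝ)).sum := by
  have h (n : ℕ) (z : ι) : ∃ r : ℚ, v z - 1 / ((n : ℝ) + 1) < r ∧ (r : ℝ) < v z :=
    exists_rat_btwn (by have : 0 < 1 / ((n : ℝ) + 1) := by positivity
                        linarith)
  choose r h1 h2 using h
  have hr (z : ι) : Tendsto (fun n => (r n z : ℝ)) atTop (𝓝 (v z)) := by
    refine tendsto_of_tendsto_of_tendsto_of_le_of_le ?_ tendsto_const_nhds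
      (fun n => (h1 n z).le) fun n => (h2 n z).le
    simpa using tendsto_one_div_add_atTop_nhds_zero_nat.const_sub (v z)
  have hs : Tendsto (fun n => (M.map fun z => contribution (c z) (r n z : ℝ)).sum) atTop
      (𝓝 (M.map fun z => contribution (c z) (v z)).sum) := by
    refine tendsto_list_sum _ fun z _ => ?_
    exact ((hr z).const_mul _).add (((hr z).sub_const 1).const_mul _)
  obtain ⟨n, hn⟩ := (hs.eventually_const_lt hq).exists
  exact ⟨r n, h2 n, hn⟩

/-- A certificate is sound by monotonicity of contributions and of measure. One exists below the sum
because the measures can first be lowered to rationals and then be replaced by those of finite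
unions, with every inequality still strict as the representation demands. -/
theorem exists_certifies_iff (χ : Measure (ℕ → ℝ)) [IsProbabilityMeasure χ]
    (M : List (List ℕ × ℚ)) (σ : List (List (ℚ × ℚ))) (q : ℚ) :
    (∃ t, Certifies M σ q t ∧ ∀ m ∈ queries t, m ∈ representation χ) ↔
      (q : ℝ) < (M.map fun z => contribution (z.2 : ℝ) (χ.real (witnessSet σ z))).sum := by
  constructor
  · rintro ⟨t, ⟨rfl, ht, hq⟩, hm⟩
    refine ((Rat.cast_lt (K := ℝ)).2 hq).trans_le ?_
    rw [Rat.cast_list_sum, List.map_map, List.map_map]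
    refine List.sum_le_sum fun z hz => ?_
    rw [Function.comp, Function.comp, cast_contribution]
    have h := (pair_mem_representation.1 (hm _ (List.mem_map.2 ⟨z, hz, rfl⟩))).2
    refine contribution_mono _ (h.le.trans (measureReal_mono ?_))
    exact Set.biUnion_subset_biUnion_left fun τ hτ => ht z hz τ hτ
  · intro hq
    obtain ⟨r, hr, hrq⟩ := exists_rat_lt_sum_contribution M (fun z => (z.2 : ℝ))
      (fun z => χ.real (witnessSet σ z)) hq
    choose B hB hBr using fun z => exists_list_lt_measureReal χ _ (hr z)
    refine ⟨M.map fun z => (z, (B z, r z)), ⟨?_, ?_, ?_⟩, ?_⟩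
    · rw [List.map_map]
      exact List.map_id _
    · intro y hy τ hτ
      obtain ⟨z, _, rfl⟩ := List.mem_map.1 hy
      exact hB z τ hτ
    · rw [← Rat.cast_lt (K := ℝ), Rat.cast_list_sum, List.map_map, List.map_map]
      simpa only [Function.comp_def, cast_contribution] using hrq
    · intro m hm
      obtain ⟨y, hy, rfl⟩ := List.mem_map.1 hm
      obtain ⟨z, _, rfl⟩ := List.mem_map.1 hy
      exact pair_mem_representation.2 ⟨fun τ hτ => (hB z τ hτ).ne_nil, hBr z⟩

/-! ### Computability of the search -/

theorem primrec_queries : Primrec queries :=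
  Primrec.list_map Primrec.id (Primrec₂.natPair.comp
    (primrec_code.comp (Primrec.fst.comp (Primrec.snd.comp Primrec.snd)))
    (primrec_code.comp (Primrec.snd.comp (Primrec.snd.comp Primrec.snd))))

theorem primrec_contribution : Primrec₂ (contribution : ℚ → ℚ → ℚ) :=
  primrec_rat_add.comp
    (primrec_rat_mul.comp (primrec_rat_max.comp Primrec.fst (Primrec.const 0)) Primrec.snd)
    (primrec_rat_mul.comp
      (primrec_rat_max.comp (primrec_rat_neg.comp Primrec.fst) (Primrec.const 0))
      (primrec_rat_sub.comp Primrec.snd (Primrec.const 1)))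

theorem primrec_positions : Primrec₂ positions :=
  Primrec.list_flatMap (Primrec.list_range.comp (Primrec.list_length.comp Primrec.fst))
    (Primrec.list_map (Primrec.list_range.comp ((Primrec.list_getD 0).comp
      (Primrec.snd.comp Primrec.fst) Primrec.snd))
      ((Primrec.list_getD []).comp (Primrec.fst.comp (Primrec.fst.comp Primrec.fst))
        (Primrec.snd.comp Primrec.fst)))

theorem primrec_dedup {α : Type*} [Primcodable α] [DecidableEq α] :
    Primrec (List.dedup : List α → List α) := by
  have hmem : PrimrecRel fun (l : List α) a => a ∈ l :=
    (PrimrecRel.exists_mem_list (R := fun a b : α => a = b) Primrec.eq).of_eq fun l a => by simp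
  refine (Primrec.list_foldr (h := fun (_ : List α) (p : α × List α) =>
    if p.1 ∈ p.2 then p.2 else p.1 :: p.2) Primrec.id (Primrec.const [])
    (Primrec.ite (hmem.comp (Primrec.snd.comp Primrec.snd) (Primrec.fst.comp Primrec.snd))
      (Primrec.snd.comp Primrec.snd)
      (Primrec.list_cons.comp (Primrec.fst.comp Primrec.snd)
        (Primrec.snd.comp Primrec.snd)))).of_eq ?_
  intro l
  induction l with
  | nil => rfl
  | cons a l ih =>
    simp only [id, List.foldr_cons] at ih ⊢
    rw [ih]
    by_cases h : a ∈ l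
    · rw [if_pos (List.mem_dedup.2 h), List.dedup_cons_of_mem h]
    · rw [if_neg (fun h' => h (List.mem_dedup.1 h')), List.dedup_cons_of_notMem h]

theorem primrec_coefficient : Primrec₂ coefficient :=
  primrec_list_sum.comp (Primrec.list_map Primrec.fst (Primrec.ite
    (Primrec.eq.comp (Primrec.fst.comp Primrec.snd) (Primrec.snd.comp Primrec.fst))
    (Primrec.snd.comp Primrec.snd) (Primrec.const 0)))

theorem primrec_collect : Primrec collect :=
  Primrec.list_map (primrec_dedup.comp (Primrec.list_map Primrec.id (Primrec.fst.comp Primrec.snd)))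
    (Primrec.pair Primrec.snd (primrec_coefficient.comp Primrec.fst Primrec.snd))

theorem primrecRel_containedCylinder : PrimrecRel ContainedCylinder := by
  have hmem : PrimrecRel fun (l : List (ℚ × ℚ)) a => a ∈ l :=
    (PrimrecRel.exists_mem_list (R := fun a b : ℚ × ℚ => a = b) Primrec.eq).of_eq
      fun l a => by simp
  have h : PrimrecRel fun (i : ℕ) (y : List (List (ℚ × ℚ)) × List (ℚ × ℚ)) =>
      y.2.getD i (0, 0) ∈ y.1.getD i [] :=
    hmem.comp ((Primrec.list_getD []).comp (Primrec.fst.comp Primrec.snd) Primrec.fst)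
      ((Primrec.list_getD (0, 0)).comp (Primrec.snd.comp Primrec.snd) Primrec.fst)
  have h' := h.forall_mem_list.comp (Primrec.list_range.comp (Primrec.list_length.comp
    (Primrec.fst (α := List (List (ℚ × ℚ))) (β := List (ℚ × ℚ))))) Primrec.id
  exact (Primrec.eq.comp (Primrec.list_length.comp Primrec.snd)
    (Primrec.succ.comp (Primrec.list_length.comp Primrec.fst))).and
    (h'.of_eq fun p => by simp only [List.mem_range, id])

theorem primrecRel_disjointCylinder : PrimrecRel DisjointCylinder := by
  have h0 : PrimrecRel fun I J : ℚ × ℚ => J.2 ≤ I.1 ∨ I.2 ≤ J.1 ∨ I.2 ≤ I.1 := by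
    have h1 : Primrec fun p : (ℚ × ℚ) × (ℚ × ℚ) => p.1.1 := Primrec.fst.comp Primrec.fst
    have h2 : Primrec fun p : (ℚ × ℚ) × (ℚ × ℚ) => p.1.2 := Primrec.snd.comp Primrec.fst
    have h3 : Primrec fun p : (ℚ × ℚ) × (ℚ × ℚ) => p.2.1 := Primrec.fst.comp Primrec.snd
    have h4 : Primrec fun p : (ℚ × ℚ) × (ℚ × ℚ) => p.2.2 := Primrec.snd.comp Primrec.snd
    exact (primrec_rat_le.comp h4 h1).or
      ((primrec_rat_le.comp h2 h3).or (primrec_rat_le.comp h2 h1))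
  have hτ : Primrec fun p : ℕ × (List (List (ℚ × ℚ)) × List (ℚ × ℚ)) =>
      p.2.2.getD p.1 (0, 0) :=
    (Primrec.list_getD (0, 0)).comp (Primrec.snd.comp Primrec.snd) Primrec.fst
  have hpos : Primrec fun p : ℕ × (List (List (ℚ × ℚ)) × List (ℚ × ℚ)) => p.2.1.getD p.1 [] :=
    (Primrec.list_getD []).comp (Primrec.fst.comp Primrec.snd) Primrec.fst
  have h : PrimrecRel fun (i : ℕ) (y : List (List (ℚ × ℚ)) × List (ℚ × ℚ)) =>
      i < y.2.length ∧ ∀ I ∈ y.1.getD i [],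
        (y.2.getD i (0, 0)).2 ≤ I.1 ∨ I.2 ≤ (y.2.getD i (0, 0)).1 ∨ I.2 ≤ I.1 :=
    (Primrec.nat_lt.comp Primrec.fst
      (Primrec.list_length.comp (Primrec.snd.comp Primrec.snd))).and
      (h0.forall_mem_list.comp hpos hτ)
  refine (h.exists_mem_list.comp (Primrec.list_range.comp (Primrec.list_length.comp
    (Primrec.fst (α := List (List (ℚ × ℚ))) (β := List (ℚ × ℚ))))) Primrec.id).of_eq fun p => ?_
  simp only [List.mem_range, id, DisjointCylinder]

theorem primrecPred_witnessCylinder :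
    PrimrecPred fun p : ℚ × List (List (ℚ × ℚ)) × List (ℚ × ℚ) =>
      WitnessCylinder p.1 p.2.1 p.2.2 := by
  have h : PrimrecPred fun p : ℚ × List (List (ℚ × ℚ)) × List (ℚ × ℚ) => 0 < p.1 :=
    primrec_rat_lt.comp (Primrec.const 0) Primrec.fst
  exact (h.and (primrecRel_containedCylinder.comp (Primrec.fst.comp Primrec.snd)
    (Primrec.snd.comp Primrec.snd))).or
    (h.not.and (primrecRel_disjointCylinder.comp (Primrec.fst.comp Primrec.snd)
    (Primrec.snd.comp Primrec.snd)))

theorem primrecPred_certifies :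
    PrimrecPred fun p : (List (List ℕ × ℚ) × List (List (ℚ × ℚ)) × ℚ) × Witness =>
      Certifies p.1.1 p.1.2.1 p.1.2.2 p.2 := by
  have h1 : PrimrecRel fun (τ : List (ℚ × ℚ)) (y : (List ℕ × ℚ) × List (List (ℚ × ℚ))) =>
      WitnessCylinder y.1.2 (positions y.2 y.1.1) τ :=
    primrecPred_witnessCylinder.comp (Primrec.pair
      (Primrec.snd.comp (Primrec.fst.comp Primrec.snd)) (Primrec.pair
        (primrec_positions.comp (Primrec.snd.comp Primrec.snd)
          (Primrec.fst.comp (Primrec.fst.comp Primrec.snd))) Primrec.fst))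
  have h2 : PrimrecRel fun (z : (List ℕ × ℚ) × (List (List (ℚ × ℚ)) × ℚ))
      (σ : List (List (ℚ × ℚ))) =>
        ∀ τ ∈ z.2.1, WitnessCylinder z.1.2 (positions σ z.1.1) τ :=
    h1.forall_mem_list.comp (Primrec.fst.comp (Primrec.snd.comp Primrec.fst))
      (Primrec.pair (Primrec.fst.comp Primrec.fst) Primrec.snd)
  have hfst : Primrec fun t : Witness => t.map Prod.fst :=
    Primrec.list_map Primrec.id (Primrec.fst.comp Primrec.snd)
  refine (Primrec.eq.comp (hfst.comp Primrec.snd) (Primrec.fst.comp Primrec.fst)).and ((h2.forall_mem_list.comp Primrec.snd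
      (Primrec.fst.comp (Primrec.snd.comp Primrec.fst))).and (primrec_rat_lt.comp
        (Primrec.snd.comp (Primrec.snd.comp Primrec.fst))
        (primrec_list_sum.comp (Primrec.list_map Primrec.snd ?_))))
  exact primrec_contribution.comp (Primrec.snd.comp (Primrec.fst.comp Primrec.snd))
    (Primrec.snd.comp (Primrec.snd.comp Primrec.snd))

/-- The terms with collected coefficients of the polynomial which the array presented by `f`
assigns to the index `n` and the matrix `C`, in `k` variables. -/
def arrayTerms (f : ℕ → ℕ) (n k : ℕ) (C : List (List ℚ)) : List (List ℕ × ℚ) :=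
  collect ((uncode (List (List ℕ × ℚ)) (f (Nat.pair n (Nat.pair k
    (code (C.map fun row => row.map fun c => (c, (2 : ℚ)))))))).getD [])

theorem computable_arrayTerms {f : ℕ → ℕ} (hf : Computable f) {α : Type*} [Primcodable α]
    {n k : α → ℕ} {C : α → List (List ℚ)} (hn : Primrec n) (hk : Primrec k) (hC : Primrec C) :
    Computable fun a => arrayTerms f (n a) (k a) (C a) := by
  have hrow : Primrec fun a => (C a).map fun row => row.map fun c => (c, (2 : ℚ)) :=
    Primrec.list_map hC (Primrec.list_map Primrec.snd
      (Primrec.pair Primrec.snd (Primrec.const 2)))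
  have h := hf.comp (Primrec₂.natPair.comp hn
    (Primrec₂.natPair.comp hk (primrec_code.comp hrow))).to_comp
  exact primrec_collect.to_comp.comp (Computable.option_getD (primrec_uncode.to_comp.comp h)
    (Computable.const []))

open Classical in
theorem computable_certifies {α : Type*} [Primcodable α] {M : α → List (List ℕ × ℚ)}
    {σ : α → List (List (ℚ × ℚ))} {q : α → ℚ} (hM : Computable M) (hσ : Computable σ)
    (hq : Computable q) :
    Computable₂ fun (a : α) (t : Witness) => decide (Certifies (M a) (σ a) (q a) t) := by
  have hdec := primrecPred_certifies.decide.to_comp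
  exact hdec.comp (Computable.pair (Computable.pair (hM.comp Computable.fst)
    (Computable.pair (hσ.comp Computable.fst) (hq.comp Computable.fst))) Computable.snd)

/-- The input does not contain the number of variables, which is recovered as the length of `σ`. -/
theorem exists_program_arrayTerms {f : ℕ → ℕ} (hf : Computable f) :
    ∃ e : OracleProgram, ∀ A (n : ℕ) (σ : List (List (ℚ × ℚ))) (C : List (List ℚ)) (q : ℚ),
      (e.eval A (code ((n, σ, C), q))).Dom ↔
        ∃ t, Certifies (arrayTerms f n σ.length C) σ q t ∧ ∀ m ∈ queries t, m ∈ A := by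
  have hσ : Primrec fun x : (ℕ × List (List (ℚ × ℚ)) × List (List ℚ)) × ℚ => x.1.2.1 :=
    Primrec.fst.comp (Primrec.snd.comp Primrec.fst)
  have hM : Computable fun x : (ℕ × List (List (ℚ × ℚ)) × List (List ℚ)) × ℚ =>
      arrayTerms f x.1.1 x.1.2.1.length x.1.2.2 :=
    computable_arrayTerms hf (Primrec.fst.comp Primrec.fst) (Primrec.list_length.comp hσ)
      (Primrec.snd.comp (Primrec.snd.comp Primrec.fst))
  obtain ⟨e, he⟩ := exists_search_program (computable_certifies hM hσ.to_comp Computable.snd)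
    primrec_queries
  refine ⟨e, fun A n σ C q => ?_⟩
  have h := he A ((n, σ, C), q)
  simp only [decide_eq_true_eq] at h
  exact h

end DeFinetti

/-! ### The search program enumerates the lower cut of the expectation. -/

theorem proposition5p6 :
    (∃ p : (k : ℕ) → ℕ → List (Fin k → ℚ × ℚ) → MvPolynomial (Fin k) ℚ,
      DeFinetti.IsApproximatingArray p) ∧
    ∀ p : (k : ℕ) → ℕ → List (Fin k → ℚ × ℚ) → MvPolynomial (Fin k) ℚ,
      DeFinetti.IsApproximatingArray p →
      ∃ e : DeFinetti.OracleProgram,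
        ∀ (Ω : Type*) [MeasurableSpace Ω] (P : Measure Ω) [IsProbabilityMeasure P]
          (X : ℕ → Ω → ℝ) (ν : Kernel Ω ℝ) [IsMarkovKernel ν],
          (∀ i, Measurable (X i)) →
          DeFinetti.Exchangeable P X →
          DeFinetti.IsDirectingMeasure P X ν →
          ∀ (n k m : ℕ), 1 ≤ k → 1 ≤ m →
            ∀ (σ : Fin k → List (ℚ × ℚ)) (C : Matrix (Fin m) (Fin k) ℚ),
              e.EnumeratesLowerCut
                (DeFinetti.representation (P.map fun ω i => X i ω))
                (Nat.pair n (Nat.pair (DeFinetti.boxesCode (List.ofFn σ))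
                  (DeFinetti.matrixCode C)))
                (DeFinetti.expectedValue P ν
                  (DeFinetti.splitPoly (DeFinetti.matrixPoly p n C)) σ) := by
  refine ⟨DeFinetti.exists_isApproximatingArray, fun p hp => ?_⟩
  obtain ⟨f, hf, hfp⟩ := hp.computable
  obtain ⟨e, he⟩ := DeFinetti.exists_program_arrayTerms hf
  refine ⟨e, fun Ω _ P _ X ν _ hX _ hν n k m hk _ σ C q => ?_⟩
  have hXm : Measurable fun ω i => X i ω := measurable_pi_lambda _ hX
  have := Measure.isProbabilityMeasure_map (μ := P) hXm.aemeasurable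
  obtain ⟨L, hpL, hL⟩ := hfp k hk n (List.ofFn fun i => fun j => (C i j, 2))
  have hrows : (List.ofFn fun i => fun j => (C i j, (2 : ℚ))).map List.ofFn =
      (List.ofFn fun i => List.ofFn fun j => C i j).map fun row => row.map fun c => (c, (2 : ℚ)) := by
    simp only [List.map_ofFn, Function.comp_def]
  have hterms : DeFinetti.arrayTerms f n (List.ofFn σ).length
      (List.ofFn fun i => List.ofFn fun j => C i j) =
        DeFinetti.collect (L.map fun t => (List.ofFn t.1, t.2)) := by
    rw [DeFinetti.arrayTerms, ← hrows, List.length_ofFn, ← DeFinetti.boxesCode_eq, hL,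
      DeFinetti.termsCode_eq, DeFinetti.uncode_code, Option.getD_some]
  rw [DeFinetti.matrixPoly, hpL, DeFinetti.expectedValue_eq hX hν,
    ← DeFinetti.exists_certifies_iff, ← hterms, DeFinetti.boxesCode_eq, DeFinetti.matrixCode_eq]
  -- The paired input is by definition the code of the tuple `((n, σ, C), q)`.
  exact he _ n _ _ q
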